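/- Let $H$ be a real separable Hilbert space, $G$ a compact Lie group acting orthogonally on $H$ (a continuous action by linear isometries), and $I=[0,1]$. Let $\mathcal{FS}(H)^G$ be the set of bounded selfadjoint Fredholm operators $T$ on $H$ with $T(gu)=g(Tu)$ for all $g\in G$, $u\in H$, with the norm topology; a path in $\mathcal{FS}(H)^G$ is a continuous map $L:I\to\mathcal{FS}(H)^G$, $\lambda\mapsto L_\lambda$. Let $RO(G)$ be the Grothendieck group of the commutative monoid (under $\oplus$) of isomorphism classes $[V]$ of finite-dimensional real continuous representations $V$ of $G$. For a bounded selfadjoint operator $T$ let $\chi_{[a,b]}(T)$ be its spectral projection for $[a,b]$ and $E(T,[a,b])=\operatorname{im}\chi_{[a,b]}(T)$. The $G$-equivariant spectral flow of a path $L$ in $\mathcal{FS}(H)^G$ is $$\operatorname{sfl}_G(L)=\sum_{i=1}^N\big([E(L_{\lambda_i},[0,a_i])]-[E(L_{\lambda_{i-1}},[0,a_i])]\big)\in RO(G),$$ where $0=\lambda_0<\dots<\lambda_N=1$ and $a_1,\dots,a_N>0$ are such that, for each $i$, $\lambda\mapsto\chi_{[-a_i,a_i]}(L_\lambda)$ is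 a continuous family of finite rank projections on $[\lambda_{i-1},\lambda_i]$. Proposition. Let $L=\{L_\lambda\}_{\lambda\in I}$ and $L'=\{L'_\lambda\}_{\lambda\in I}$ be paths in $\mathcal{FS}(H)^G$ such that $L_0=L'_0$, $L_1=L'_1$ and $L_\lambda-L'_\lambda$ is compact for all $\lambda\in I$. Then $\operatorname{sfl}_G(L)$ and $\operatorname{sfl}_G(L')$ are well defined (partitions and numbers $a_i$ as above exist, and the sum does not depend on their choice), and $$\operatorname{sfl}_G(L)=\operatorname{sfl}_G(L').$$ -/

import Mathlib

open scoped Manifold ContDiff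

universe u v

noncomputable section

namespace EquivariantSpectralFlow

/-! ### The representation ring `RO(G)`, as an abelian group -/

/-- A finite-dimensional real representation of the topological group `G`.  Continuity of
`G → GL(V)` is expressed by continuity of all matrix coefficients. -/
structure RealRep (G : Type v) [Group G] [TopologicalSpace G] where
  V : Type u
  [addCommGroup : AddCommGroup V]
  [module : Module ℝ V]
  [finiteDimensional : FiniteDimensional ℝ V]
  ρ : Representation ℝ G V
  continuous_coeff : ∀ (f : V →ₗ[ℝ] ℝ) (x : V), Continuous fun g : G => f (ρ g x)

attribute [instance] RealRep.addCommGroup RealRep.module RealRep.finiteDimensional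

section RepresentationRing

variable (G : Type v) [Group G] [TopologicalSpace G]

/-- Isomorphism of representations: a `G`-equivariant linear isomorphism exists. -/
instance RealRep.setoid : Setoid (RealRep.{u, v} G) where
  r A B := Nonempty (A.ρ.Equiv B.ρ)
  iseqv :=
    { refl := fun A => ⟨Representation.Equiv.refl A.ρ⟩
      symm := fun ⟨e⟩ => ⟨e.symm⟩
      trans := fun ⟨e⟩ ⟨f⟩ => ⟨e.trans f⟩ }

variable {G}

/-- The direct sum of two representations. -/
def RealRep.sum (A B : RealRep.{u, v} G) : RealRep.{u, v} G where
  V := A.V × B.V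
  ρ := A.ρ.prod B.ρ
  continuous_coeff := fun f x => by
    have h : (fun g : G => f ((A.ρ.prod B.ρ) g x)) = fun g : G =>
        (f ∘ₗ LinearMap.inl ℝ A.V B.V) (A.ρ g x.1) +
          (f ∘ₗ LinearMap.inr ℝ A.V B.V) (B.ρ g x.2) := by
      funext g
      simp [← map_add]
    rw [h]
    exact (A.continuous_coeff _ _).add (B.continuous_coeff _ _)

/-- The zero representation. -/
def RealRep.zero : RealRep.{u, v} G where
  V := PUnit.{u + 1}
  ρ := Representation.trivial ℝ G PUnit.{u + 1}
  continuous_coeff := fun f x => by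
    simpa using (continuous_const : Continuous fun _ : G => f x)

variable (G)

/-- Isomorphism classes of finite-dimensional real representations of `G`. -/
def RepClass : Type (max v (u + 1)) := Quotient (RealRep.setoid.{u, v} G)

variable {G}

/-- Addition of isomorphism classes, induced by the direct sum. -/
def RepClass.add : RepClass.{u, v} G → RepClass.{u, v} G → RepClass.{u, v} G :=
  Quotient.map₂ RealRep.sum (by
    rintro A A' ⟨e⟩ B B' ⟨f⟩
    refine ⟨Representation.Equiv.mk (e.toLinearEquiv.prodCongr f.toLinearEquiv) ?_⟩
    intro g
    refine LinearMap.ext fun x => Prod.ext ?_ ?_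
    · exact Representation.IntertwiningMap.isIntertwining _ _ e.toIntertwiningMap g x.1
    · exact Representation.IntertwiningMap.isIntertwining _ _ f.toIntertwiningMap g x.2)

instance : Add (RepClass.{u, v} G) := ⟨RepClass.add⟩

instance : Zero (RepClass.{u, v} G) := ⟨Quotient.mk _ RealRep.zero⟩

instance : AddCommMonoid (RepClass.{u, v} G) where
  nsmul := nsmulRec
  add_assoc := by
    rintro ⟨A⟩ ⟨B⟩ ⟨C⟩
    refine Quotient.sound ⟨Representation.Equiv.mk (LinearEquiv.prodAssoc ℝ A.V B.V C.V) ?_⟩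
    intro g
    rfl
  add_comm := by
    rintro ⟨A⟩ ⟨B⟩
    refine Quotient.sound ⟨Representation.Equiv.mk (LinearEquiv.prodComm ℝ A.V B.V) ?_⟩
    intro g
    rfl
  zero_add := by
    rintro ⟨A⟩
    refine Quotient.sound
      ⟨Representation.Equiv.mk (LinearEquiv.uniqueProd (R := ℝ) (M := A.V) (M₂ := PUnit.{u + 1})) ?_⟩
    intro g
    rfl
  add_zero := by
    rintro ⟨A⟩
    refine Quotient.sound
      ⟨Representation.Equiv.mk (LinearEquiv.prodUnique (R := ℝ) (M := A.V) (M₂ := PUnit.{u + 1})) ?_⟩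
    intro g
    rfl

variable (G)

/-- `RO(G)`: the Grothendieck group of the monoid of isomorphism classes of finite-dimensional
real representations of `G` under direct sum. -/
abbrev RO : Type (max v (u + 1)) := Algebra.GrothendieckAddGroup (RepClass.{u, v} G)

variable {G}

/-- The class `[A] ∈ RO(G)` of a representation `A`. -/
def RO.mk (A : RealRep.{u, v} G) : RO.{u, v} G :=
  Algebra.GrothendieckAddGroup.of (Quotient.mk _ A : RepClass.{u, v} G)

end RepresentationRing

/-! ### Spectral projections -/

section Spectral

variable {H : Type u} [NormedAddCommGroup H] [InnerProductSpace ℝ H]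

/-- `P = χ_{[a,b]}(T)` for a bounded selfadjoint operator `T` on a real Hilbert space, by the
Riesz–Nagy construction of the functional calculus: there are real polynomials `p₀ ≥ p₁ ≥ …`
on the spectrum of `T` that decrease pointwise on it to the indicator function of `[a,b]`, and `P`
is the strong limit of the operators `pₙ(T)`.  For selfadjoint `T` exactly one such `P` exists. -/
def IsSpectralProjection (T : H →L[ℝ] H) (a b : ℝ) (P : H →L[ℝ] H) : Prop :=
  ∃ p : ℕ → Polynomial ℝ,
    (∀ t ∈ spectrum ℝ T, Antitone fun n => (p n).eval t) ∧
    (∀ t ∈ spectrum ℝ T, Filter.Tendsto (fun n => (p n).eval t) Filter.atTop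
      (nhds ((Set.Icc a b).indicator 1 t))) ∧
    ∀ x : H, Filter.Tendsto (fun n => Polynomial.aeval T (p n) x) Filter.atTop (nhds (P x))

open Classical in
/-- The spectral projection `χ_{[a,b]}(T)` of a bounded selfadjoint operator. -/
def spectralProjection (T : H →L[ℝ] H) (a b : ℝ) : H →L[ℝ] H :=
  if h : ∃ P, IsSpectralProjection T a b P then h.choose else 0

/-- The spectral subspace `E(T,[a,b]) = im χ_{[a,b]}(T)`. -/
def spectralSubspace (T : H →L[ℝ] H) (a b : ℝ) : Submodule ℝ H :=
  (spectralProjection T a b).range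

end Spectral

/-! ### Equivariant operators and the equivariant spectral flow

An orthogonal action of `G` on `H` is a continuous action by linear isometries. -/

section Flow

variable (G : Type v) [Group G] [TopologicalSpace G]
variable (H : Type u) [NormedAddCommGroup H] [InnerProductSpace ℝ H] [CompleteSpace H]
variable [DistribMulAction G H] [SMulCommClass G ℝ H]

/-- `FS(H)^G`: the `G`-equivariant bounded selfadjoint Fredholm operators on `H`; it carries the
topology of the operator norm. -/
def FS : Set (H →L[ℝ] H) :=
  {T | IsSelfAdjoint T ∧ T.IsFredholm ∧ ∀ (g : G) (x : H), T (g • x) = g • T x}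

variable {H}
variable [ContinuousSMul G H]

/-- A finite-dimensional `G`-invariant subspace of `H`, as a representation of `G`. -/
def subspaceRep (E : Submodule ℝ H) (hfin : FiniteDimensional ℝ E)
    (hinv : ∀ (g : G), ∀ x ∈ E, g • x ∈ E) : RealRep.{u, v} G where
  V := E
  finiteDimensional := hfin
  ρ := (Representation.ofDistribMulAction ℝ G H).subrepresentation E fun g x hx => hinv g x hx
  continuous_coeff := fun f x => by
    have hf : Continuous f := LinearMap.continuous_of_finiteDimensional f
    refine hf.comp (Continuous.subtype_mk (f := fun g : G => g • (x : H)) ?_ fun g => hinv g x x.2)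
    exact continuous_id.smul continuous_const

open Classical in
/-- The class `[E] ∈ RO(G)` of a finite-dimensional `G`-invariant subspace `E` of `H`
(and `0` for all other subspaces, to which it is never applied). -/
def subspaceClass (E : Submodule ℝ H) : RO.{u, v} G :=
  if h : FiniteDimensional ℝ E ∧ ∀ (g : G), ∀ x ∈ E, g • x ∈ E then
    RO.mk (subspaceRep G E h.1 h.2)
  else 0

variable {G}

/-- A partition `0 = t₀ < … < t_N = 1` with numbers `a₁, …, a_N > 0` (here indexed from `0`) such
that on each closed subinterval the projections `χ_{[-aᵢ,aᵢ]}(L_s)` form a continuous family of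
finite rank projections. -/
structure AdmissiblePartition (L : C(unitInterval, FS G H)) where
  N : ℕ
  t : Fin (N + 1) → unitInterval
  t_zero : t 0 = 0
  t_last : t (Fin.last N) = 1
  strictMono_t : StrictMono t
  a : Fin N → ℝ
  a_pos : ∀ i, 0 < a i
  continuousOn : ∀ i, ContinuousOn
    (fun s => spectralProjection (L s : H →L[ℝ] H) (-a i) (a i))
    (Set.Icc (t i.castSucc) (t i.succ))
  finite_rank : ∀ i, ∀ s ∈ Set.Icc (t i.castSucc) (t i.succ),
    FiniteDimensional ℝ (spectralProjection (L s : H →L[ℝ] H) (-a i) (a i)).range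

/-- The sum `∑ᵢ ([E(L_{tᵢ},[0,aᵢ])] - [E(L_{tᵢ₋₁},[0,aᵢ])])` in `RO(G)`. -/
def AdmissiblePartition.flow {L : C(unitInterval, FS G H)} (D : AdmissiblePartition L) :
    RO.{u, v} G :=
  ∑ i : Fin D.N,
    (subspaceClass G (spectralSubspace (L (D.t i.succ) : H →L[ℝ] H) 0 (D.a i)) -
      subspaceClass G (spectralSubspace (L (D.t i.castSucc) : H →L[ℝ] H) 0 (D.a i)))

/-- `x` is a value of the defining sum of the spectral flow, for some admissible partition. -/
def IsSpectralFlow (L : C(unitInterval, FS G H)) (x : RO.{u, v} G) : Prop :=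
  ∃ D : AdmissiblePartition L, D.flow = x

open Classical in
/-- The `G`-equivariant spectral flow `sfl_G(L) ∈ RO(G)`: the value of the defining sum for any
admissible partition. -/
def sfl (L : C(unitInterval, FS G H)) : RO.{u, v} G :=
  if h : ∃ x, IsSpectralFlow L x then h.choose else 0

end Flow

end EquivariantSpectralFlow

end

/-! The paths are joined by the straight homotopy `L_t - s (L_t - L'_t)`. Each operator in it is a
selfadjoint Fredholm operator plus a compact selfadjoint one, hence bounded below off a
finite-dimensional subspace (`BoundedBelowModFinite.add_compact`). That is enough for some
`χ_{[-a,a]}` to have finite rank and depend continuously on the operator nearby, so a Lebesgue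
number gives a grid on the square with one admissible `a` per cell. In particular both paths have
admissible partitions.

The key fact is `spectralClass_sub_eq`: on a preconnected set where `a` and `b` are both admissible,
increments of `[E(T,[0,a])]` and `[E(T,[0,b])]` agree. For `a ≤ b` the two classes differ by the
class of the spectral subspace of `(a,b]`. The projections `χ_{[0,a]}` and `χ_{[0,b]}` may jump, but
`χ_{[-b,b]} - χ_{[-a,a]}` is continuous and `T` has forms at least `a` and at most `-a` on its
positive and negative parts. Hence the parts of nearby operators inject equivariantly into one
another, a rank count makes the injections bijective, and the class is locally constant. Applied
piecewise, this gives independence of the partition. Applied on the edges of the grid, it makes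
contributions of neighbouring cells cancel, so the flow is the same along all rows.

The spectral projections are handled through order: an inequality between limit functions on the
spectrum becomes one between quadratic forms (`IsDecreasingLimit.inner_le`). Uniqueness, products
and spectral estimates follow from scalar inequalities between indicator functions and polynomials.
-/

noncomputable section

namespace EquivariantSpectralFlow

open Filter Topology Polynomial

/-! ### Positivity of polynomials in a selfadjoint operator on a real Hilbert space -/

section Operators

set_option linter.unusedSectionVars false

variable {H : Type u} [NormedAddCommGroup H] [InnerProductSpace ℝ H] [CompleteSpace H]

theorem inner_apply_comm {T : H →L[ℝ] H} (hT : IsSelfAdjoint T) (x y : H) :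
    inner ℝ (T x) y = inner ℝ x (T y) :=
  hT.isSymmetric x y

/-- Expand the nonnegative form of `R` at `x - C⁻¹ R x` and bound the quadratic term by the upper
bound on `R`. This turns control of forms into control of norms. -/
theorem norm_apply_sq_le_mul_inner {R : H →L[ℝ] H} (hR : IsSelfAdjoint R) {C : ℝ} (hC : 0 < C)
    (h0 : ∀ x, 0 ≤ inner ℝ (R x) x) (hle : ∀ x, inner ℝ (R x) x ≤ C * ‖x‖ ^ 2) (x : H) :
    ‖R x‖ ^ 2 ≤ C * inner ℝ (R x) x := by
  have h1 := h0 (x - C⁻¹ • R x)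
  have h2 := hle (R x)
  have h3 : inner ℝ (R (x - C⁻¹ • R x)) (x - C⁻¹ • R x) =
      inner ℝ (R x) x - 2 * C⁻¹ * ‖R x‖ ^ 2 + C⁻¹ ^ 2 * inner ℝ (R (R x)) (R x) := by
    simp only [map_sub, map_smul, inner_sub_left, inner_sub_right, real_inner_smul_left,
      real_inner_smul_right, real_inner_self_eq_norm_sq, inner_apply_comm hR (R x) x]
    ring
  rw [h3] at h1
  have h4 : C⁻¹ ^ 2 * inner ℝ (R (R x)) (R x) ≤ C⁻¹ * ‖R x‖ ^ 2 := by
    calc _ ≤ C⁻¹ ^ 2 * (C * ‖R x‖ ^ 2) := by gcongr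
      _ = _ := by field_simp
  have h5 : C⁻¹ * ‖R x‖ ^ 2 ≤ inner ℝ (R x) x := by linarith
  calc ‖R x‖ ^ 2 = C * (C⁻¹ * ‖R x‖ ^ 2) := by field_simp
    _ ≤ _ := by gcongr

theorem norm_apply_le_of_abs_inner_le {S : H →L[ℝ] H} (hS : IsSelfAdjoint S) {ε : ℝ} (hε : 0 < ε)
    (h : ∀ x, |inner ℝ (S x) x| ≤ ε * ‖x‖ ^ 2) : ‖S‖ ≤ ε := by
  rw [ContinuousLinearMap.norm_eq_iSup_rayleighQuotient _ hS.isSymmetric]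
  refine ciSup_le fun x => ?_
  rw [ContinuousLinearMap.rayleighQuotient, ContinuousLinearMap.reApplyInnerSelf_apply, abs_div,
    abs_of_nonneg (sq_nonneg ‖x‖)]
  exact div_le_of_le_mul₀ (sq_nonneg _) hε.le (h x)

theorem exists_le_norm_apply_of_isUnit {R : H →L[ℝ] H} (hR : IsUnit R) :
    ∃ k > 0, ∀ x, k * ‖x‖ ≤ ‖R x‖ := by
  obtain ⟨u, rfl⟩ := hR
  refine ⟨(‖(↑u⁻¹ : H →L[ℝ] H)‖ + 1)⁻¹, by positivity, fun x => ?_⟩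
  rw [inv_mul_le_iff₀ (by positivity)]
  have h : (↑u⁻¹ : H →L[ℝ] H) ((u : H →L[ℝ] H) x) = x := by
    rw [← mul_apply_eq_comp, Units.inv_mul, one_apply_eq_self]
  calc ‖x‖ = ‖(↑u⁻¹ : H →L[ℝ] H) ((u : H →L[ℝ] H) x)‖ := by rw [h]
    _ ≤ ‖(↑u⁻¹ : H →L[ℝ] H)‖ * ‖(u : H →L[ℝ] H) x‖ := ContinuousLinearMap.le_opNorm _ _
    _ ≤ _ := by gcongr; linarith

/-- A selfadjoint operator which is bounded below is invertible. -/
theorem isUnit_of_le_norm_apply {R : H →L[ℝ] H} (hR : IsSelfAdjoint R) {k : ℝ} (hk : 0 < k)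
    (h : ∀ x, k * ‖x‖ ≤ ‖R x‖) : IsUnit R := by
  have h2 : IsUnit (R * R) := by
    refine ContinuousLinearMap.isUnit_of_forall_le_norm_inner_map (R * R)
      (c := (k ^ 2).toNNReal) (Real.toNNReal_pos.2 (by positivity)) fun x => ?_
    rw [mul_apply_eq_comp, inner_apply_comm hR, real_inner_self_eq_norm_sq,
      Real.norm_of_nonneg (by positivity), Real.coe_toNNReal _ (by positivity)]
    have := pow_le_pow_left₀ (by positivity) (h x) 2
    simpa [mul_pow, mul_comm] using this
  exact (Commute.isUnit_mul_iff (Commute.refl R)).1 h2 |>.1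

theorem isSelfAdjoint_algebraMap (t : ℝ) : IsSelfAdjoint (algebraMap ℝ (H →L[ℝ] H) t) :=
  IsSelfAdjoint.algebraMap _ (IsSelfAdjoint.all t)

theorem notMem_spectrum_of_le {T : H →L[ℝ] H} (hT : IsSelfAdjoint T) {t k : ℝ} (hk : 0 < k)
    (h : ∀ x, k * ‖x‖ ≤ ‖T x - t • x‖) : t ∉ spectrum ℝ T := by
  rw [spectrum.notMem_iff]
  refine isUnit_of_le_norm_apply ((isSelfAdjoint_algebraMap t).sub hT) hk fun x => ?_
  rw [sub_apply, norm_sub_rev]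
  simpa [Algebra.algebraMap_eq_smul_one] using h x

/-- Let `t₀ ≥ 0` be least with `S + t₀ ≥ 0`. If `t₀ > 0`, then `-t₀` is off the spectrum, so `S +
t₀` is nonnegative and invertible. By `norm_apply_sq_le_mul_inner` its form is then bounded below by
a positive multiple of `‖x‖²`, so `t₀` can be decreased. -/
theorem inner_nonneg_of_spectrum_nonneg {S : H →L[ℝ] H} (hS : IsSelfAdjoint S)
    (h : ∀ t ∈ spectrum ℝ S, 0 ≤ t) (x : H) : 0 ≤ inner ℝ (S x) x := by
  set A : Set ℝ := {t | 0 ≤ t ∧ ∀ x, 0 ≤ inner ℝ (S x) x + t * ‖x‖ ^ 2} with hA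
  have hbdd : BddBelow A := ⟨0, fun t ht => ht.1⟩
  have habs : ∀ x, |inner ℝ (S x) x| ≤ ‖S‖ * ‖x‖ ^ 2 := fun x =>
    calc |inner ℝ (S x) x| ≤ ‖S x‖ * ‖x‖ := abs_real_inner_le_norm _ _
      _ ≤ ‖S‖ * ‖x‖ * ‖x‖ := by gcongr; exact S.le_opNorm x
      _ = _ := by ring
  have hne : A.Nonempty := ⟨‖S‖, norm_nonneg _, fun x => by linarith [neg_le_of_abs_le (habs x)]⟩
  have hclosed : IsClosed A := by
    simp only [hA, Set.ofPred_and, Set.ofPred_forall]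
    refine isClosed_Ici.inter (isClosed_iInter fun x => ?_)
    exact isClosed_le (by fun_prop) (by fun_prop)
  have hmem : sInf A ∈ A := hclosed.csInf_mem hne hbdd
  set t₀ := sInf A
  rcases hmem.1.eq_or_lt with h0 | h0
  · simpa [← h0] using hmem.2 x
  exfalso
  have hns : (-t₀) ∉ spectrum ℝ S := fun hm => by linarith [h _ hm]
  rw [spectrum.notMem_iff] at hns
  obtain ⟨k, hk, hkx⟩ := exists_le_norm_apply_of_isUnit hns.neg
  set R : H →L[ℝ] H := -((algebraMap ℝ (H →L[ℝ] H)) (-t₀) - S) with hRdef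
  have hRx : ∀ x, R x = S x + t₀ • x := fun x => by
    simp [hRdef, Algebra.algebraMap_eq_smul_one, neg_sub]
  have hR : IsSelfAdjoint R := ((isSelfAdjoint_algebraMap _).sub hS).neg
  have hinner : ∀ x, inner ℝ (R x) x = inner ℝ (S x) x + t₀ * ‖x‖ ^ 2 := fun x => by
    rw [hRx, inner_add_left, real_inner_smul_left, real_inner_self_eq_norm_sq]
  have hC : 0 < ‖S‖ + t₀ := by positivity
  have key : ∀ x, k ^ 2 * ‖x‖ ^ 2 ≤ (‖S‖ + t₀) * inner ℝ (R x) x := fun x => by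
    have h1 := norm_apply_sq_le_mul_inner hR hC (fun x => by rw [hinner]; exact hmem.2 x)
      (fun x => by rw [hinner]; linarith [le_of_abs_le (habs x)]) x
    have h2 := pow_le_pow_left₀ (by positivity) (hkx x) 2
    rw [mul_pow] at h2
    exact h2.trans h1
  set d := min t₀ (k ^ 2 / (‖S‖ + t₀)) with hd
  have hd0 : 0 < d := lt_min h0 (by positivity)
  have : t₀ - d ∈ A := by
    refine ⟨by linarith [min_le_left t₀ (k ^ 2 / (‖S‖ + t₀))], fun x => ?_⟩
    have h1 : d * ‖x‖ ^ 2 ≤ inner ℝ (R x) x := by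
      calc d * ‖x‖ ^ 2 ≤ k ^ 2 / (‖S‖ + t₀) * ‖x‖ ^ 2 := by gcongr; exact min_le_right _ _
        _ = k ^ 2 * ‖x‖ ^ 2 / (‖S‖ + t₀) := by ring
        _ ≤ _ := by rw [div_le_iff₀ hC]; linarith [key x]
    rw [hinner] at h1
    linarith
  linarith [csInf_le hbdd this]

/-- Real irreducibles have degree one or two. A linear factor is a resolvent up to a scalar.
Completing the square in a quadratic one gives `a ((T + m)² + e)` with `e > 0`, invertible since `(T
+ m)² ≥ 0`. -/
theorem isUnit_aeval_of_irreducible {T : H →L[ℝ] H} (hT : IsSelfAdjoint T) {p : ℝ[X]}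
    (hp : Irreducible p) (h : ∀ t ∈ spectrum ℝ T, p.eval t ≠ 0) : IsUnit (aeval T p) := by
  have hdeg := natDegree_le_iff_degree_le.2 hp.degree_le_two
  have hpos := hp.natDegree_pos
  obtain hd | hd : p.natDegree = 1 ∨ p.natDegree = 2 := by
    have : p.natDegree ≤ 2 := hdeg
    omega
  · obtain ⟨a, ha, b, hab⟩ := natDegree_eq_one.1 hd
    have hns : (-b / a) ∉ spectrum ℝ T := fun hm => h _ hm (by rw [← hab]; simp; field_simp; ring)
    rw [spectrum.notMem_iff] at hns
    have : aeval T p = algebraMap ℝ (H →L[ℝ] H) (-a) * (algebraMap ℝ (H →L[ℝ] H) (-b / a) - T) := by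
      rw [mul_sub, ← map_mul, ← hab]
      have : -a * (-b / a) = b := by field_simp
      rw [this]; simp [add_comm]
    rw [this]
    exact ((IsUnit.mk0 (-a) (neg_ne_zero.2 ha)).map _).mul hns
  · have hroot : ∀ t, p.eval t ≠ 0 := fun t ht => by
      have := degree_eq_one_of_irreducible_of_root hp (show IsRoot p t from ht)
      rw [degree_eq_natDegree hp.ne_zero, hd] at this
      norm_num at this
    set a := p.coeff 2 with ha
    set b := p.coeff 1
    set c := p.coeff 0
    have ha0 : a ≠ 0 := by
      have := leadingCoeff_ne_zero.2 hp.ne_zero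
      rwa [leadingCoeff, hd] at this
    have hpe : p = C a * X ^ 2 + C b * X + C c := by
      conv_lhs => rw [p.as_sum_range_C_mul_X_pow, hd]
      simp [Finset.sum_range_succ, a, b, c]; ring
    have hev : ∀ t, p.eval t = a * (t + b / (2 * a)) ^ 2 + (c - b ^ 2 / (4 * a)) := fun t => by
      rw [hpe]; simp; field_simp; ring
    set m := b / (2 * a)
    set e := (c - b ^ 2 / (4 * a)) / a with he
    have hev' : ∀ t, p.eval t = a * ((t + m) ^ 2 + e) := fun t => by
      rw [hev, he]; field_simp
    have he0 : 0 < e := by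
      by_contra hcon
      apply hroot (-m + Real.sqrt (-e))
      rw [hev']
      have := Real.sq_sqrt (show 0 ≤ -e by linarith)
      have h3 : (-m + Real.sqrt (-e) + m) ^ 2 = -e := by
        rw [neg_add_cancel_comm]; exact this
      rw [h3]; ring
    set B : H →L[ℝ] H := T + algebraMap ℝ (H →L[ℝ] H) m with hB
    have hBs : IsSelfAdjoint B := hT.add (isSelfAdjoint_algebraMap _)
    have hpT : aeval T p = algebraMap ℝ (H →L[ℝ] H) a * (B * B + algebraMap ℝ (H →L[ℝ] H) e) := by
      have : p = C a * ((X + C m) * (X + C m) + C e) := by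
        refine Polynomial.funext fun t => ?_
        rw [hev']; simp; ring_nf; simp
      rw [this]; simp [hB]
    rw [hpT]
    refine ((IsUnit.mk0 a ha0).map _).mul ?_
    refine ContinuousLinearMap.isUnit_of_forall_le_norm_inner_map _
      (c := e.toNNReal) (Real.toNNReal_pos.2 he0) fun x => ?_
    rw [add_apply, mul_apply_eq_comp, inner_add_left,
      inner_apply_comm hBs, real_inner_self_eq_norm_sq]
    have h4 : inner ℝ ((algebraMap ℝ (H →L[ℝ] H) e) x) x = e * ‖x‖ ^ 2 := by
      simp [Algebra.algebraMap_eq_smul_one, real_inner_smul_left]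
    rw [h4, Real.norm_of_nonneg (by positivity), Real.coe_toNNReal _ he0.le]
    nlinarith [sq_nonneg ‖B x‖]

theorem isUnit_aeval {T : H →L[ℝ] H} (hT : IsSelfAdjoint T) {p : ℝ[X]} (hp0 : p ≠ 0)
    (h : ∀ t ∈ spectrum ℝ T, p.eval t ≠ 0) : IsUnit (aeval T p) := by
  induction p using WfDvdMonoid.induction_on_irreducible with
  | zero => exact absurd rfl hp0
  | unit u hu => exact hu.map _
  | mul q i hq hi ih =>
    rw [map_mul]
    refine (isUnit_aeval_of_irreducible hT hi fun t ht h0 => h t ht (by simp [h0])).mul ?_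
    exact ih hq fun t ht h0 => h t ht (by simp [h0])

theorem isSelfAdjoint_aeval {T : H →L[ℝ] H} (hT : IsSelfAdjoint T) (p : ℝ[X]) :
    IsSelfAdjoint (aeval T p) := by
  induction p using Polynomial.induction_on' with
  | add p q hp hq => rw [map_add]; exact hp.add hq
  | monomial n a =>
    rw [aeval_monomial, ← Algebra.smul_def]
    exact (IsSelfAdjoint.all a).smul (hT.pow n)

/-- With empty spectrum every `T - s` would be nonnegative, which fails at `x ≠ 0` once `s` exceeds
the Rayleigh quotient of `x`. -/
theorem eq_zero_of_spectrum_eq_empty {T : H →L[ℝ] H} (hT : IsSelfAdjoint T)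
    (h : spectrum ℝ T = ∅) (x : H) : x = 0 := by
  by_contra hx
  set s := inner ℝ (T x) x / ‖x‖ ^ 2 + 1 with hs
  have hx2 : 0 < ‖x‖ ^ 2 := by positivity
  have h1 := inner_nonneg_of_spectrum_nonneg (S := T - algebraMap ℝ (H →L[ℝ] H) s)
    (hT.sub (isSelfAdjoint_algebraMap s)) (fun t ht => by
      exfalso
      have hm : t + s ∉ spectrum ℝ T := by simp [h]
      rw [spectrum.notMem_iff] at hm
      rw [spectrum.mem_iff] at ht
      apply ht
      rwa [sub_sub_eq_add_sub, ← map_add]) x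
  have h2 : inner ℝ ((algebraMap ℝ (H →L[ℝ] H) s) x) x = s * ‖x‖ ^ 2 := by
    simp [Algebra.algebraMap_eq_smul_one, real_inner_smul_left]
  rw [sub_apply, inner_sub_left, h2, hs, add_mul, div_mul_cancel₀ _ hx2.ne'] at h1
  linarith

/-- For `t < 0` the polynomial `t - p` has no zero on the spectrum of `T`, so `t - p(T)` is
invertible. Only `p = t` needs separate care: then the spectrum is empty and `H` is trivial. -/
theorem inner_aeval_nonneg {T : H →L[ℝ] H} (hT : IsSelfAdjoint T) {p : ℝ[X]}
    (h : ∀ t ∈ spectrum ℝ T, 0 ≤ p.eval t) (x : H) : 0 ≤ inner ℝ (aeval T p x) x := by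
  refine inner_nonneg_of_spectrum_nonneg (isSelfAdjoint_aeval hT p) (fun t ht => ?_) x
  by_contra! hcon
  rw [spectrum.mem_iff] at ht
  apply ht
  have hne : ∀ s ∈ spectrum ℝ T, (C t - p).eval s ≠ 0 := fun s hs => by
    have := h s hs
    simp only [eval_sub, eval_C]; linarith
  by_cases h0 : C t - p = 0
  · have hp : p = C t := (sub_eq_zero.1 h0).symm
    have hemp : spectrum ℝ T = ∅ := Set.eq_empty_of_forall_notMem fun s hs => hne s hs (by simp [h0])
    have hH := eq_zero_of_spectrum_eq_empty hT hemp
    have : Subsingleton (H →L[ℝ] H) :=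
      ⟨fun A B => ContinuousLinearMap.ext fun x => by rw [hH x, map_zero, map_zero]⟩
    exact isUnit_of_subsingleton _
  · have := isUnit_aeval hT h0 hne
    simpa using this

theorem inner_aeval_le {T : H →L[ℝ] H} (hT : IsSelfAdjoint T) {p q : ℝ[X]}
    (h : ∀ t ∈ spectrum ℝ T, p.eval t ≤ q.eval t) (x : H) :
    inner ℝ (aeval T p x) x ≤ inner ℝ (aeval T q x) x := by
  have := inner_aeval_nonneg hT (p := q - p) (fun t ht => by simpa using h t ht) x
  rw [map_sub, sub_apply, inner_sub_left] at this
  linarith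

end Operators

/-! ### Riesz–Nagy functional calculus by decreasing limits -/

section DecreasingLimits

set_option linter.unusedSectionVars false

variable {H : Type u} [NormedAddCommGroup H] [InnerProductSpace ℝ H] [CompleteSpace H]

/-- `S` is the strong limit of the operators `pₙ(T)`, for polynomials `pₙ` that decrease to `f` on
the spectrum of `T`. -/
def IsDecreasingLimit (T : H →L[ℝ] H) (f : ℝ → ℝ) (S : H →L[ℝ] H) : Prop :=
  ∃ p : ℕ → ℝ[X],
    (∀ t ∈ spectrum ℝ T, Antitone fun n => (p n).eval t) ∧
    (∀ t ∈ spectrum ℝ T, Tendsto (fun n => (p n).eval t) atTop (𝓝 (f t))) ∧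
    ∀ x : H, Tendsto (fun n => aeval T (p n) x) atTop (𝓝 (S x))

namespace IsDecreasingLimit

variable {T S R : H →L[ℝ] H} {f g : ℝ → ℝ}

theorem of_polynomial (T : H →L[ℝ] H) (p : ℝ[X]) :
    IsDecreasingLimit T (fun t => p.eval t) (aeval T p) :=
  ⟨fun _ => p, fun _ _ => antitone_const, fun _ _ => tendsto_const_nhds,
    fun _ => tendsto_const_nhds⟩

theorem add (hS : IsDecreasingLimit T f S) (hR : IsDecreasingLimit T g R) :
    IsDecreasingLimit T (fun t => f t + g t) (S + R) := by
  obtain ⟨p, hp, hpf, hpS⟩ := hS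
  obtain ⟨q, hq, hqg, hqR⟩ := hR
  refine ⟨fun n => p n + q n, fun t ht => ?_, fun t ht => ?_, fun x => ?_⟩
  · simpa using (hp t ht).add (hq t ht)
  · simpa using (hpf t ht).add (hqg t ht)
  · simpa using (hpS x).add (hqR x)

theorem const_mul (hS : IsDecreasingLimit T f S) {c : ℝ} (hc : 0 ≤ c) :
    IsDecreasingLimit T (fun t => c * f t) (c • S) := by
  obtain ⟨p, hp, hpf, hpS⟩ := hS
  refine ⟨fun n => C c * p n, fun t ht => ?_, fun t ht => ?_, fun x => ?_⟩
  · simpa using (hp t ht).const_mul hc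
  · simpa using (hpf t ht).const_mul c
  · simpa [Algebra.algebraMap_eq_smul_one] using (hpS x).const_smul c

/-- Nonnegative limits make both factors nonnegative, so the products still decrease. The uniform
boundedness principle bounds `‖pₙ(T)‖`, which makes strong limits multiply. -/
theorem mul (hS : IsDecreasingLimit T f S) (hR : IsDecreasingLimit T g R)
    (hf : ∀ t ∈ spectrum ℝ T, 0 ≤ f t) (hg : ∀ t ∈ spectrum ℝ T, 0 ≤ g t) :
    IsDecreasingLimit T (fun t => f t * g t) (S * R) := by
  obtain ⟨p, hp, hpf, hpS⟩ := hS
  obtain ⟨q, hq, hqg, hqR⟩ := hR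
  refine ⟨fun n => p n * q n, fun t ht => ?_, fun t ht => ?_, fun x => ?_⟩
  · intro m n hmn
    simp only [eval_mul]
    exact mul_le_mul (hp t ht hmn) (hq t ht hmn)
      ((hg t ht).trans ((hq t ht).le_of_tendsto (hqg t ht) n))
      ((hf t ht).trans ((hp t ht).le_of_tendsto (hpf t ht) m))
  · simpa using (hpf t ht).mul (hqg t ht)
  · have hbdd : ∃ K, ∀ n, ‖aeval T (p n)‖ ≤ K := by
      refine banach_steinhaus (g := fun n => aeval T (p n)) fun y => ?_
      obtain ⟨K, hK⟩ := ((hpS y).norm).bddAbove_range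
      exact ⟨K, fun n => hK ⟨n, rfl⟩⟩
    obtain ⟨K, hK⟩ := hbdd
    have h1 : Tendsto (fun n => aeval T (p n) (aeval T (q n) x - R x)) atTop (𝓝 0) := by
      refine squeeze_zero_norm (a := fun n => K * ‖aeval T (q n) x - R x‖) (fun n => ?_) ?_
      · exact (ContinuousLinearMap.le_opNorm _ _).trans (by gcongr; exact hK n)
      · have := ((hqR x).sub_const (R x)).norm.const_mul K
        simpa using this
    have h2 := h1.add (hpS (R x))
    simpa using h2

theorem isSelfAdjoint (hT : IsSelfAdjoint T) (hS : IsDecreasingLimit T f S) : IsSelfAdjoint S := by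
  obtain ⟨p, -, -, hpS⟩ := hS
  rw [ContinuousLinearMap.isSelfAdjoint_iff_isSymmetric]
  intro x y
  have h1 := (hpS x).inner (𝕜 := ℝ) (tendsto_const_nhds (x := y))
  have h2 := (tendsto_const_nhds (x := x)).inner (𝕜 := ℝ) (hpS y)
  refine tendsto_nhds_unique h1 (h2.congr fun n => ?_)
  exact (inner_apply_comm (isSelfAdjoint_aeval hT (p n)) x y).symm

/-- For fixed `n`, Dini's theorem on the compact spectrum gives `p_m ≤ q_n + δ` for some `m`.
Compare the forms of these polynomials and let `δ → 0`, then `n → ∞`. -/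
theorem inner_le (hT : IsSelfAdjoint T) (hS : IsDecreasingLimit T f S)
    (hR : IsDecreasingLimit T g R) (hfg : ∀ t ∈ spectrum ℝ T, f t ≤ g t) (x : H) :
    inner ℝ (S x) x ≤ inner ℝ (R x) x := by
  obtain ⟨p, hp, hpf, hpS⟩ := hS
  obtain ⟨q, hq, hqg, hqR⟩ := hR
  have hlimS : Tendsto (fun n => inner ℝ (aeval T (p n) x) x) atTop (𝓝 (inner ℝ (S x) x)) :=
    (hpS x).inner tendsto_const_nhds
  have hlimR : Tendsto (fun n => inner ℝ (aeval T (q n) x) x) atTop (𝓝 (inner ℝ (R x) x)) :=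
    (hqR x).inner tendsto_const_nhds
  have hantiS : Antitone fun n => inner ℝ (aeval T (p n) x) x := fun m n hmn =>
    inner_aeval_le hT (fun t ht => hp t ht hmn) x
  refine ge_of_tendsto' hlimR fun n => ?_
  refine le_of_forall_pos_le_add fun ε hε => ?_
  set δ := ε / (‖x‖ ^ 2 + 1) with hδ
  have hδ0 : 0 < δ := by positivity
  have hdini : TendstoUniformlyOn (fun m t => max ((p m).eval t - (q n).eval t) 0) (fun _ => 0)
      atTop (spectrum ℝ T) := by
    refine Antitone.tendstoUniformlyOn_of_forall_tendsto (spectrum.isCompact T)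
      (fun m => by fun_prop) (fun t ht m k hmk => ?_) continuousOn_const fun t ht => ?_
    · exact max_le_max (sub_le_sub_right (hp t ht hmk) _) le_rfl
    · have h1 := ((hpf t ht).sub_const ((q n).eval t)).max (tendsto_const_nhds (x := (0 : ℝ)))
      have h2 : f t ≤ (q n).eval t := (hfg t ht).trans ((hq t ht).le_of_tendsto (hqg t ht) n)
      rwa [max_eq_right (by linarith)] at h1
  obtain ⟨m, hm⟩ := (Metric.tendstoUniformlyOn_iff.1 hdini δ hδ0).exists
  have h1 := inner_aeval_le hT (p := p m) (q := q n + C δ) (fun t ht => by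
    have := hm t ht
    rw [Real.dist_eq, zero_sub, abs_neg, abs_of_nonneg (le_max_right _ _)] at this
    have := (le_max_left _ _).trans_lt this
    simp only [eval_add, eval_C]; linarith) x
  have h2 : inner ℝ (aeval T (q n + C δ) x) x = inner ℝ (aeval T (q n) x) x + δ * ‖x‖ ^ 2 := by
    simp [inner_add_left, Algebra.algebraMap_eq_smul_one, real_inner_smul_left]
  have h3 : δ * ‖x‖ ^ 2 ≤ ε := by
    rw [hδ, div_mul_eq_mul_div, div_le_iff₀ (by positivity)]
    nlinarith [sq_nonneg ‖x‖]
  have h4 := hantiS.le_of_tendsto hlimS m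
  linarith

/-- Monotonicity in both directions equates the quadratic forms, and a selfadjoint operator with
zero form vanishes. Identities between spectral projections thereby reduce to identities between
indicators. -/
theorem unique (hT : IsSelfAdjoint T) (hS : IsDecreasingLimit T f S)
    (hR : IsDecreasingLimit T g R) (hfg : ∀ t ∈ spectrum ℝ T, f t = g t) : S = R := by
  have hsym : IsSelfAdjoint (S - R) := (hS.isSelfAdjoint hT).sub (hR.isSelfAdjoint hT)
  have h0 : ∀ x, inner ℝ ((S - R) x) x = 0 := fun x => by
    rw [sub_apply, inner_sub_left, sub_eq_zero]
    exact le_antisymm (inner_le hT hS hR (fun t ht => (hfg t ht).le) x)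
      (inner_le hT hR hS (fun t ht => (hfg t ht).ge) x)
  refine sub_eq_zero.1 (ContinuousLinearMap.ext fun x => ?_)
  have := norm_apply_sq_le_mul_inner hsym one_pos (fun x => (h0 x).ge)
    (fun x => by rw [h0]; positivity) x
  rw [h0, mul_zero] at this
  simpa using le_antisymm this (sq_nonneg _)

theorem norm_sub_le (hT : IsSelfAdjoint T) (hS : IsDecreasingLimit T f S) (p : ℝ[X]) {ε : ℝ}
    (hε : 0 < ε) (h : ∀ t ∈ spectrum ℝ T, |p.eval t - f t| ≤ ε) : ‖aeval T p - S‖ ≤ ε := by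
  refine norm_apply_le_of_abs_inner_le ((isSelfAdjoint_aeval hT p).sub (hS.isSelfAdjoint hT)) hε
    fun x => ?_
  have hε' : inner ℝ (aeval T (C ε) x) x = ε * ‖x‖ ^ 2 := by
    simp [Algebra.algebraMap_eq_smul_one, real_inner_smul_left]
  have h1 := inner_le hT (of_polynomial T p) (hS.add (of_polynomial T (C ε)))
    (fun t ht => by have := abs_le.1 (h t ht); simp only [eval_C]; linarith) x
  have h2 := inner_le hT hS ((of_polynomial T p).add (of_polynomial T (C ε)))
    (fun t ht => by have := abs_le.1 (h t ht); simp only [eval_C]; linarith) x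
  rw [add_apply, inner_add_left, hε'] at h1 h2
  rw [sub_apply, inner_sub_left, abs_le]
  constructor <;> linarith

end IsDecreasingLimit

theorem spectrum_subset_Icc (T : H →L[ℝ] H) : ∃ M, 0 ≤ M ∧ spectrum ℝ T ⊆ Set.Icc (-M) M := by
  obtain ⟨M, hM⟩ := (spectrum.isCompact (𝕜 := ℝ) T).isBounded.exists_norm_le
  exact ⟨max M 0, le_max_right _ _, fun t ht => abs_le.1 ((hM t ht).trans (le_max_left _ _))⟩

/-- A sequence of polynomials that decreases on the spectrum to a function that is bounded below
gives a strongly convergent sequence of operators. -/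
theorem exists_isDecreasingLimit {T : H →L[ℝ] H} (hT : IsSelfAdjoint T) {p : ℕ → ℝ[X]} {f : ℝ → ℝ}
    (hp : ∀ t ∈ spectrum ℝ T, Antitone fun n => (p n).eval t)
    (hf : ∀ t ∈ spectrum ℝ T, Tendsto (fun n => (p n).eval t) atTop (𝓝 (f t)))
    (hf0 : ∀ t ∈ spectrum ℝ T, 0 ≤ f t) : ∃ S, IsDecreasingLimit T f S := by
  obtain ⟨K, hK⟩ := ((spectrum.isCompact T).image_of_continuousOn (f := fun t => (p 0).eval t)
    (by fun_prop)).bddAbove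
  have hK' : ∀ t ∈ spectrum ℝ T, (p 0).eval t ≤ K := fun t ht => hK ⟨t, ht, rfl⟩
  have hp0 : ∀ n, ∀ t ∈ spectrum ℝ T, 0 ≤ (p n).eval t := fun n t ht =>
    (hf0 t ht).trans ((hp t ht).le_of_tendsto (hf t ht) n)
  set L := max K 1
  have hL : 0 < L := lt_max_of_lt_right one_pos
  have hcauchy : ∀ x, CauchySeq fun n => aeval T (p n) x := fun x => by
    have hanti : Antitone fun n => inner ℝ (aeval T (p n) x) x := fun m n hmn =>
      inner_aeval_le hT (fun t ht => hp t ht hmn) x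
    have hbdd : BddBelow (Set.range fun n => inner ℝ (aeval T (p n) x) x) :=
      ⟨0, by rintro _ ⟨n, rfl⟩; exact inner_aeval_nonneg hT (hp0 n) x⟩
    have hc := (tendsto_atTop_ciInf hanti hbdd).cauchySeq
    rw [Metric.cauchySeq_iff'] at hc ⊢
    intro ε hε
    obtain ⟨N, hN⟩ := hc (ε ^ 2 / L) (by positivity)
    refine ⟨N, fun n hn => ?_⟩
    have h1 := hN n hn
    -- With `0 ≤ p_N - p_n ≤ L` on the spectrum, convergence of the monotone forms forces `pₙ(T) x`
    -- to be Cauchy.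
    have h2 := norm_apply_sq_le_mul_inner (isSelfAdjoint_aeval hT (p N - p n)) hL
      (inner_aeval_nonneg hT fun t ht => by simpa using hp t ht hn)
      (fun y => by
        have := inner_aeval_le hT (p := p N - p n) (q := C L) (fun t ht => by
          have h3 := hp t ht (Nat.zero_le N)
          have h4 := hp0 n t ht
          have h5 := hK' t ht
          simp only [eval_sub, eval_C] at h3 ⊢
          linarith [le_max_left K 1]) y
        refine this.trans (le_of_eq ?_)
        simp [Algebra.algebraMap_eq_smul_one, real_inner_smul_left]) x
    rw [map_sub, sub_apply, inner_sub_left] at h2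
    rw [dist_comm, Real.dist_eq] at h1
    rw [dist_comm, dist_eq_norm]
    have h3 := lt_of_le_of_lt (le_abs_self _) h1
    rw [lt_div_iff₀ hL] at h3
    exact lt_of_pow_lt_pow_left₀ 2 hε.le (by linarith)
  choose s hs using fun x => cauchySeq_tendsto_of_complete (hcauchy x)
  exact ⟨continuousLinearMapOfTendsto (fun n => aeval T (p n)) (f := s) (tendsto_pi_nhds.2 hs),
    p, hp, hf, hs⟩

/-- Piecewise linear functions decreasing to the indicator function of `[a, b]`. -/
def hat (a b : ℝ) (n : ℕ) (t : ℝ) : ℝ := max 0 (1 - n * Metric.infDist t (Set.Icc a b))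

theorem continuous_hat (a b : ℝ) (n : ℕ) : Continuous (hat a b n) := by
  unfold hat
  exact continuous_const.max (continuous_const.sub
    (continuous_const.mul (Metric.continuous_infDist_pt _)))

theorem hat_antitone (a b t : ℝ) : Antitone fun n => hat a b n t := fun m n hmn => by
  have : (m : ℝ) ≤ n := by exact_mod_cast hmn
  exact max_le_max le_rfl
    (sub_le_sub_left (mul_le_mul_of_nonneg_right this Metric.infDist_nonneg) 1)

theorem tendsto_hat {a b : ℝ} (hab : a ≤ b) (t : ℝ) :
    Tendsto (fun n => hat a b n t) atTop (𝓝 ((Set.Icc a b).indicator 1 t)) := by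
  by_cases ht : t ∈ Set.Icc a b
  · rw [Set.indicator_of_mem ht]
    simp [hat, Metric.infDist_zero_of_mem ht]
  · rw [Set.indicator_of_notMem ht]
    have hd : 0 < Metric.infDist t (Set.Icc a b) :=
      (isClosed_Icc.notMem_iff_infDist_pos (Set.nonempty_Icc.2 hab)).1 ht
    refine tendsto_const_nhds.congr' ?_
    obtain ⟨N, hN⟩ := exists_nat_gt (Metric.infDist t (Set.Icc a b))⁻¹
    filter_upwards [eventually_ge_atTop N] with n hn
    unfold hat
    rw [eq_comm, max_eq_left]
    have : (N : ℝ) ≤ n := by exact_mod_cast hn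
    have h1 : 1 ≤ N * Metric.infDist t (Set.Icc a b) := by
      rw [← div_le_iff₀ hd, one_div]; exact hN.le
    nlinarith

theorem exists_isSpectralProjection {T : H →L[ℝ] H} (hT : IsSelfAdjoint T) {a b : ℝ}
    (hab : a ≤ b) : ∃ P, IsSpectralProjection T a b P := by
  obtain ⟨M, -, hM⟩ := spectrum_subset_Icc T
  -- The shift `3 · 2⁻ⁿ` absorbs the approximation errors: `p_{n+1} ≤ hat_{n+1} + 2 · 2⁻ⁿ ≤ hat_n +
  -- 2 · 2⁻ⁿ ≤ p_n`.
  have happrox : ∀ n : ℕ, ∃ p : ℝ[X], ∀ t ∈ Set.Icc (-M) M,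
      |p.eval t - (hat a b n t + 3 * (1 / 2) ^ n)| < (1 / 2) ^ n := fun n =>
    exists_polynomial_near_of_continuousOn _ _ _
      ((continuous_hat a b n).add continuous_const).continuousOn _ (by positivity)
  choose p hp using happrox
  refine exists_isDecreasingLimit hT (p := p) (f := (Set.Icc a b).indicator 1) (fun t ht => ?_)
    (fun t ht => ?_) fun t _ => Set.indicator_nonneg (fun _ _ => zero_le_one) t
  · refine antitone_nat_of_succ_le fun n => ?_
    have h1 := abs_lt.1 (hp n t (hM ht))
    have h2 := abs_lt.1 (hp (n + 1) t (hM ht))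
    have h3 : hat a b (n + 1) t ≤ hat a b n t := hat_antitone a b t n.le_succ
    rw [pow_succ] at h2
    linarith
  · have hpow : Tendsto (fun n : ℕ => ((1 : ℝ) / 2) ^ n) atTop (𝓝 0) :=
      tendsto_pow_atTop_nhds_zero_of_lt_one (by norm_num) (by norm_num)
    have h1 : Tendsto (fun n => (p n).eval t - (hat a b n t + 3 * (1 / 2) ^ n)) atTop (𝓝 0) :=
      squeeze_zero_norm (fun n => (hp n t (hM ht)).le) hpow
    have h2 := h1.add ((tendsto_hat hab t).add (hpow.const_mul 3))
    simpa using h2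

theorem isSpectralProjection_spectralProjection {T : H →L[ℝ] H} (hT : IsSelfAdjoint T) {a b : ℝ}
    (hab : a ≤ b) : IsDecreasingLimit T ((Set.Icc a b).indicator 1) (spectralProjection T a b) := by
  have h := exists_isSpectralProjection hT hab
  unfold spectralProjection
  rw [dif_pos h]
  exact h.choose_spec

end DecreasingLimits

/-! ### Spectral projections: algebra, estimates, continuity and finite rank -/

section SpectralProjections

set_option linter.unusedSectionVars false

variable {H : Type u} [NormedAddCommGroup H] [InnerProductSpace ℝ H] [CompleteSpace H]

theorem isSelfAdjoint_spectralProjection {T : H →L[ℝ] H} (hT : IsSelfAdjoint T) {a b : ℝ}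
    (hab : a ≤ b) : IsSelfAdjoint (spectralProjection T a b) :=
  (isSpectralProjection_spectralProjection hT hab).isSelfAdjoint hT

theorem spectralProjection_apply_apply_of_inter {T : H →L[ℝ] H} (hT : IsSelfAdjoint T)
    {a b c d e f : ℝ} (hab : a ≤ b) (hcd : c ≤ d) (hef : e ≤ f)
    (h : Set.Icc a b ∩ Set.Icc c d = Set.Icc e f) (x : H) :
    spectralProjection T a b (spectralProjection T c d x) = spectralProjection T e f x := by
  refine DFunLike.congr_fun (((isSpectralProjection_spectralProjection hT hab).mul
    (isSpectralProjection_spectralProjection hT hcd)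
    (fun t _ => Set.indicator_nonneg (fun _ _ => zero_le_one) t)
    (fun t _ => Set.indicator_nonneg (fun _ _ => zero_le_one) t)).unique hT
    (isSpectralProjection_spectralProjection hT hef) fun t _ => ?_) x
  rw [← h, Set.inter_indicator_one, Pi.mul_apply]

theorem spectralProjection_apply_apply {T : H →L[ℝ] H} (hT : IsSelfAdjoint T) {a b c d : ℝ}
    (hab : a ≤ b) (hcd : c ≤ d) (hca : a ≤ c) (hdb : d ≤ b) (x : H) :
    spectralProjection T a b (spectralProjection T c d x) = spectralProjection T c d x :=
  spectralProjection_apply_apply_of_inter hT hab hcd hcd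
    (Set.inter_eq_right.2 (Set.Icc_subset_Icc hca hdb)) x

theorem spectralProjection_apply_apply' {T : H →L[ℝ] H} (hT : IsSelfAdjoint T) {a b c d : ℝ}
    (hab : a ≤ b) (hcd : c ≤ d) (hca : a ≤ c) (hdb : d ≤ b) (x : H) :
    spectralProjection T c d (spectralProjection T a b x) = spectralProjection T c d x :=
  spectralProjection_apply_apply_of_inter hT hcd hab hcd
    (Set.inter_eq_left.2 (Set.Icc_subset_Icc hca hdb)) x

/-- Stated for a homogeneous additive map so that it covers both `T` itself and the action of a
group element. -/
theorem aeval_apply_comm {T : H →L[ℝ] H} {A : H →+ H} (hA : ∀ (c : ℝ) x, A (c • x) = c • A x)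
    (h : ∀ x, T (A x) = A (T x)) (p : ℝ[X]) (x : H) : aeval T p (A x) = A (aeval T p x) := by
  induction p using Polynomial.induction_on' generalizing x with
  | add p q hp hq => simp [hp, hq]
  | monomial n a =>
    have hpow : ∀ n x, (T ^ n) (A x) = A ((T ^ n) x) := fun n => by
      induction n with
      | zero => simp
      | succ n ih => intro x; rw [pow_succ, mul_apply_eq_comp, mul_apply_eq_comp, h, ih]
    rw [aeval_monomial, ← Algebra.smul_def, smul_apply, smul_apply, hpow, hA]

theorem spectralProjection_apply_comm {T : H →L[ℝ] H} (hT : IsSelfAdjoint T) {a b : ℝ}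
    (hab : a ≤ b) {A : H →+ H} (hA : ∀ (c : ℝ) x, A (c • x) = c • A x) (hcont : Continuous A)
    (h : ∀ x, T (A x) = A (T x)) (x : H) :
    spectralProjection T a b (A x) = A (spectralProjection T a b x) := by
  obtain ⟨p, -, -, hp⟩ := isSpectralProjection_spectralProjection hT hab
  refine tendsto_nhds_unique (hp (A x)) ?_
  refine ((hcont.tendsto _).comp (hp x)).congr fun n => ?_
  exact (aeval_apply_comm hA h (p n) x).symm

theorem spectralProjection_apply_self_comm {T : H →L[ℝ] H} (hT : IsSelfAdjoint T) {a b : ℝ}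
    (hab : a ≤ b) (x : H) : spectralProjection T a b (T x) = T (spectralProjection T a b x) :=
  spectralProjection_apply_comm hT hab (A := (T : H →+ H)) (fun c x => map_smul T c x)
    T.continuous (fun _ => rfl) x

theorem mem_range_spectralProjection {T : H →L[ℝ] H} (hT : IsSelfAdjoint T) {a b : ℝ}
    (hab : a ≤ b) {x : H} :
    x ∈ (spectralProjection T a b).range ↔ spectralProjection T a b x = x := by
  constructor
  · rintro ⟨y, rfl⟩
    exact spectralProjection_apply_apply hT hab hab le_rfl le_rfl y
  · exact fun h => ⟨x, h⟩

theorem inner_aeval_sq {T : H →L[ℝ] H} (hT : IsSelfAdjoint T) (x : H) :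
    inner ℝ (aeval T (X ^ 2 : ℝ[X]) x) x = ‖T x‖ ^ 2 := by
  rw [map_pow, aeval_X, pow_two, mul_apply_eq_comp, inner_apply_comm hT, real_inner_self_eq_norm_sq]

theorem inner_aeval_C (T : H →L[ℝ] H) (c : ℝ) (x : H) :
    inner ℝ (aeval T (C c : ℝ[X]) x) x = c * ‖x‖ ^ 2 := by
  simp [Algebra.algebraMap_eq_smul_one, real_inner_smul_left]

/-- Operator form of `t² + M² χ_{[-a,a]} ≤ a² + M²` on the spectrum. Here and in the next estimates
indicators enter with nonnegative coefficients on both sides, because decreasing limits are not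
closed under subtraction. -/
theorem norm_apply_le_of_mem {T : H →L[ℝ] H} (hT : IsSelfAdjoint T) {a : ℝ} (ha : 0 ≤ a) {x : H}
    (hx : spectralProjection T (-a) a x = x) : ‖T x‖ ≤ a * ‖x‖ := by
  obtain ⟨M, hM0, hM⟩ := spectrum_subset_Icc T
  have hP := isSpectralProjection_spectralProjection hT (show -a ≤ a by linarith)
  have h := ((IsDecreasingLimit.of_polynomial T (X ^ 2)).add
    (hP.const_mul (sq_nonneg M))).inner_le hT
    (IsDecreasingLimit.of_polynomial T (C (a ^ 2 + M ^ 2))) (fun t ht => by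
      simp only [eval_pow, eval_X, eval_C]
      have h1 : t ^ 2 ≤ M ^ 2 := sq_le_sq' (hM ht).1 (hM ht).2
      by_cases hta : t ∈ Set.Icc (-a) a
      · rw [Set.indicator_of_mem hta]
        have := sq_le_sq' hta.1 hta.2
        simp only [Pi.one_apply]; linarith
      · rw [Set.indicator_of_notMem hta]
        nlinarith [sq_nonneg a]) x
  rw [add_apply, smul_apply, hx, inner_add_left, inner_aeval_sq hT, inner_aeval_C,
    real_inner_smul_left, real_inner_self_eq_norm_sq] at h
  refine abs_le_of_sq_le_sq' ?_ (by positivity) |>.2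
  nlinarith

theorem le_norm_apply_of_apply_eq_zero {T : H →L[ℝ] H} (hT : IsSelfAdjoint T) {a : ℝ} (ha : 0 ≤ a)
    {x : H} (hx : spectralProjection T (-a) a x = 0) : a * ‖x‖ ≤ ‖T x‖ := by
  have hP := isSpectralProjection_spectralProjection hT (show -a ≤ a by linarith)
  have h := (IsDecreasingLimit.of_polynomial T (C (a ^ 2))).inner_le hT
    ((IsDecreasingLimit.of_polynomial T (X ^ 2)).add (hP.const_mul (sq_nonneg a))) (fun t ht => by
      simp only [eval_pow, eval_X, eval_C]
      by_cases hta : t ∈ Set.Icc (-a) a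
      · rw [Set.indicator_of_mem hta]
        simp only [Pi.one_apply]; nlinarith
      · rw [Set.indicator_of_notMem hta, mul_zero, add_zero, sq_le_sq, abs_of_nonneg ha]
        by_contra! hcon
        exact hta (abs_le.1 hcon.le)) x
  rw [add_apply, smul_apply, hx, inner_add_left, inner_aeval_sq hT, inner_aeval_C] at h
  refine abs_le_of_sq_le_sq' ?_ (by positivity) |>.2
  simp only [smul_zero, inner_zero_left, add_zero] at h
  nlinarith

/-- Operator form of `a + (a + M) χ_{[0,b]} ≤ t + (a + M) + a χ_{[0,a]}`, valid for `t ≥ -M`. -/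
theorem le_inner_of_mem_of_apply_eq_zero {T : H →L[ℝ] H} (hT : IsSelfAdjoint T) {a b : ℝ}
    (ha : 0 ≤ a) (hab : a ≤ b) {x : H} (hxb : spectralProjection T 0 b x = x)
    (hxa : spectralProjection T 0 a x = 0) : a * ‖x‖ ^ 2 ≤ inner ℝ (T x) x := by
  obtain ⟨M, hM0, hM⟩ := spectrum_subset_Icc T
  have hK : 0 ≤ a + M := by linarith
  have hB := isSpectralProjection_spectralProjection hT (ha.trans hab)
  have hA := isSpectralProjection_spectralProjection hT ha
  have h := ((IsDecreasingLimit.of_polynomial T (C a)).add (hB.const_mul hK)).inner_le hT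
    ((IsDecreasingLimit.of_polynomial T (X + C (a + M))).add (hA.const_mul ha)) (fun t ht => by
      have hMt := (hM ht).1
      simp only [eval_add, eval_X, eval_C]
      by_cases hta : t ∈ Set.Icc 0 a
      · rw [Set.indicator_of_mem hta, Set.indicator_of_mem (Set.Icc_subset_Icc_right hab hta)]
        simp only [Pi.one_apply]
        linarith [hta.1]
      · rw [Set.indicator_of_notMem hta]
        by_cases htb : t ∈ Set.Icc 0 b
        · rw [Set.indicator_of_mem htb]
          have : a < t := by
            by_contra! hcon
            exact hta ⟨htb.1, hcon⟩
          simp only [Pi.one_apply]; linarith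
        · rw [Set.indicator_of_notMem htb]; linarith) x
  rw [add_apply, add_apply, smul_apply, smul_apply, hxa, hxb, inner_add_left, inner_add_left,
    map_add, add_apply, inner_add_left, inner_aeval_C, inner_aeval_C, aeval_X,
    real_inner_smul_left, real_inner_self_eq_norm_sq, smul_zero, inner_zero_left] at h
  linarith

/-- Operator form of `t + (a + M) χ_{[-b,b]} ≤ M + (a + M) (χ_{[-a,a]} + χ_{[0,b]})`, valid for `t ≤
M`. -/
theorem inner_le_of_mem_of_apply_eq_zero {T : H →L[ℝ] H} (hT : IsSelfAdjoint T) {a b : ℝ}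
    (ha : 0 ≤ a) (hab : a ≤ b) {x : H} (hx : spectralProjection T (-b) b x = x)
    (hxa : spectralProjection T (-a) a x = 0) (hxb : spectralProjection T 0 b x = 0) :
    inner ℝ (T x) x ≤ -a * ‖x‖ ^ 2 := by
  obtain ⟨M, hM0, hM⟩ := spectrum_subset_Icc T
  have hK : 0 ≤ a + M := by linarith
  have hA := isSpectralProjection_spectralProjection hT (show -b ≤ b by linarith)
  have hB := isSpectralProjection_spectralProjection hT (show -a ≤ a by linarith)
  have hC := isSpectralProjection_spectralProjection hT (ha.trans hab)
  have h := ((IsDecreasingLimit.of_polynomial T X).add (hA.const_mul hK)).inner_le hT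
    ((IsDecreasingLimit.of_polynomial T (C M)).add ((hB.const_mul hK).add (hC.const_mul hK)))
    (fun t ht => by
      have hMt := (hM ht).2
      have hB0 : 0 ≤ (a + M) * (Set.Icc (-a) a).indicator 1 t :=
        mul_nonneg hK (Set.indicator_nonneg (fun _ _ => zero_le_one) t)
      have hC0 : 0 ≤ (a + M) * (Set.Icc 0 b).indicator 1 t :=
        mul_nonneg hK (Set.indicator_nonneg (fun _ _ => zero_le_one) t)
      simp only [eval_X, eval_C]
      by_cases htb : t ∈ Set.Icc (-b) b
      · rw [Set.indicator_of_mem htb]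
        by_cases hta : t ∈ Set.Icc (-a) a
        · rw [Set.indicator_of_mem hta]
          linarith
        · by_cases htc : t ∈ Set.Icc 0 b
          · rw [Set.indicator_of_mem htc]
            linarith
          · have : t ≤ -a := by
              by_contra! hcon
              rcases le_total 0 t with h0 | h0
              · exact htc ⟨h0, htb.2⟩
              · exact hta ⟨hcon.le, h0.trans ha⟩
            simp only [Pi.one_apply]
            linarith
      · rw [Set.indicator_of_notMem htb]
        linarith) x
  rw [add_apply, add_apply, add_apply, smul_apply, smul_apply, smul_apply, hx, hxa, hxb,
    inner_add_left, inner_add_left, inner_aeval_C, aeval_X, real_inner_smul_left,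
    real_inner_self_eq_norm_sq, smul_zero, add_zero, inner_zero_left] at h
  linarith

/-! ### Continuity across spectral gaps -/

/-- Across the gap the indicator agrees with a continuous function falling from 1 to 0 as `|t|` runs
from `a - c/2` to `a + c/2`. Polynomial approximation of it on `[-M, M]` makes the projection a
uniform limit of the continuous maps `T ↦ p(T)`. -/
theorem continuousOn_spectralProjection_of_gap {U : Set (H →L[ℝ] H)} (hU : ∀ T ∈ U, IsSelfAdjoint T)
    {M : ℝ} (hM : ∀ T ∈ U, ‖T‖ ≤ M) {a c : ℝ} (ha : 0 < a) (hc : 0 < c)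
    (hgap : ∀ T ∈ U, ∀ t ∈ spectrum ℝ T, c / 2 ≤ |(|t| - a)|) :
    ContinuousOn (fun T => spectralProjection T (-a) a) U := by
  set g : ℝ → ℝ := fun t => max 0 (min 1 (1 / 2 + (a - |t|) / c)) with hg
  have hgc : Continuous g := by fun_prop
  have hgind : ∀ t : ℝ, c / 2 ≤ |(|t| - a)| → g t = (Set.Icc (-a) a).indicator 1 t := fun t ht => by
    rcases le_abs.1 ht with h | h
    · have h1 : t ∉ Set.Icc (-a) a := fun h2 => by linarith [abs_le.2 h2]
      rw [Set.indicator_of_notMem h1, hg]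
      have : (a - |t|) / c ≤ -(1 / 2) := by rw [div_le_iff₀ hc]; linarith
      exact max_eq_left ((min_le_right _ _).trans (by linarith))
    · have h1 : t ∈ Set.Icc (-a) a := abs_le.1 (by linarith)
      rw [Set.indicator_of_mem h1, hg]
      have : 1 / 2 ≤ (a - |t|) / c := by rw [le_div_iff₀ hc]; linarith
      simp only [Pi.one_apply]
      rw [min_eq_left (by linarith), max_eq_right zero_le_one]
  refine continuousOn_of_uniform_approx_of_continuousOn fun V hV => ?_
  obtain ⟨ε, hε, hεV⟩ := Metric.mem_uniformity_dist.1 hV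
  obtain ⟨p, hp⟩ := exists_polynomial_near_of_continuousOn (-M) M g hgc.continuousOn (ε / 2)
    (by positivity)
  refine ⟨fun T => aeval T p, (Polynomial.continuous_aeval p).continuousOn, fun T hT => ?_⟩
  refine hεV ?_
  rw [dist_comm, dist_eq_norm]
  refine lt_of_le_of_lt ((isSpectralProjection_spectralProjection (hU T hT)
    (show -a ≤ a by linarith)).norm_sub_le (hU T hT) p (half_pos hε) fun t ht => ?_) (half_lt_self hε)
  rw [← hgind t (hgap T hT t ht)]
  refine (hp t (abs_le.1 ?_)).le
  have h1 : ‖t‖ ≤ ‖T‖ * ‖(1 : H →L[ℝ] H)‖ := spectrum.norm_le_norm_mul_of_mem ht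
  have h2 : ‖(1 : H →L[ℝ] H)‖ ≤ 1 := ContinuousLinearMap.norm_id_le
  calc |t| ≤ ‖T‖ * ‖(1 : H →L[ℝ] H)‖ := h1
    _ ≤ ‖T‖ * 1 := by gcongr
    _ ≤ M := by rw [mul_one]; exact hM T hT

theorem continuousOn_spectralProjection {T₀ : H →L[ℝ] H} {a c : ℝ} (ha : 0 < a) (hc : 0 < c)
    (h₁ : ∀ x, c * ‖x‖ ≤ ‖T₀ x - a • x‖) (h₂ : ∀ x, c * ‖x‖ ≤ ‖T₀ x - (-a) • x‖) :
    ContinuousOn (fun T => spectralProjection T (-a) a)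
      ({T | IsSelfAdjoint T} ∩ Metric.ball T₀ (c / 2)) := by
  refine continuousOn_spectralProjection_of_gap (fun T hT => hT.1) (M := ‖T₀‖ + c)
    (fun T hT => ?_) ha hc fun T hT t ht => ?_
  · have := hT.2
    rw [mem_ball_iff_norm] at this
    linarith [norm_le_norm_add_norm_sub' T T₀]
  · by_contra! hcon
    have hT2 := hT.2
    rw [mem_ball_iff_norm] at hT2
    obtain ⟨s, hs, hst⟩ : ∃ s, (∀ x, c * ‖x‖ ≤ ‖T₀ x - s • x‖) ∧ |t - s| < c / 2 := by
      rcases le_total 0 t with h0 | h0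
      · exact ⟨a, h₁, by rwa [abs_of_nonneg h0] at hcon⟩
      · refine ⟨-a, h₂, ?_⟩
        rw [abs_of_nonpos h0] at hcon
        rwa [show t - -a = -(-t - a) by ring, abs_neg]
    -- The lower bound `c` for `T₀ - s` loses less than `c/2` in passing from `T₀` to `T`, and less
    -- than `c/2` from `s` to `t`.
    refine notMem_spectrum_of_le hT.1 (k := c - ‖T - T₀‖ - |t - s|) (by linarith) (fun x => ?_) ht
    have h3 : T₀ x - s • x = (T x - t • x) - (T - T₀) x + (t - s) • x := by
      rw [sub_apply, sub_smul]; abel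
    have h4 : ‖T₀ x - s • x‖ ≤ ‖T x - t • x‖ + ‖T - T₀‖ * ‖x‖ + |t - s| * ‖x‖ := by
      rw [h3]
      refine (norm_add_le _ _).trans ?_
      refine add_le_add ((norm_sub_le _ _).trans ?_) (by rw [norm_smul, Real.norm_eq_abs])
      gcongr
      exact ContinuousLinearMap.le_opNorm _ _
    have := hs x
    nlinarith

/-! ### Operators that are bounded below modulo a finite-dimensional subspace -/

/-- `T` is bounded below on the orthogonal complement of a finite-dimensional subspace. -/
def BoundedBelowModFinite (T : H →L[ℝ] H) : Prop :=
  ∃ V : Submodule ℝ H, FiniteDimensional ℝ V ∧ ∃ δ > 0, ∀ x ∈ Vᗮ, δ * ‖x‖ ≤ ‖T x‖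

/-- Off its finite-dimensional kernel `T` is injective with the same closed range, hence bounded
below. -/
theorem _root_.ContinuousLinearMap.IsFredholm.boundedBelowModFinite {T : H →L[ℝ] H}
    (hT : T.IsFredholm) : BoundedBelowModFinite T := by
  have hfin := hT.finite_ker
  refine ⟨T.ker, hfin, ?_⟩
  have hrange : (T ∘L (T.ker)ᗮ.subtypeL).range = T.range := by
    refine le_antisymm ?_ ?_
    · rintro _ ⟨x, rfl⟩
      exact ⟨x, rfl⟩
    · rintro _ ⟨x, rfl⟩
      obtain ⟨y, hy, z, hz, rfl⟩ := T.ker.exists_add_mem_mem_orthogonal x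
      have hy' : T y = 0 := hy
      exact ⟨⟨z, hz⟩, by simp [hy']⟩
  have hinj : Function.Injective (T ∘L (T.ker)ᗮ.subtypeL) := by
    rw [injective_iff_map_eq_zero]
    rintro ⟨x, hx⟩ h0
    have hx0 : x ∈ T.ker := h0
    have := Submodule.inner_right_of_mem_orthogonal hx0 hx
    rw [inner_self_eq_zero] at this
    exact Subtype.ext this
  obtain ⟨K, hK⟩ := ContinuousLinearMap.antilipschitz_of_injective_of_isClosed_range
    (T ∘L (T.ker)ᗮ.subtypeL) hinj (by
      have := hT.isClosed_range
      rw [← hrange] at this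
      exact this)
  refine ⟨(K + 1)⁻¹, by positivity, fun x hx => ?_⟩
  rw [inv_mul_le_iff₀ (by positivity)]
  have h1 := hK.le_mul_dist ⟨x, hx⟩ 0
  rw [dist_zero_right, map_zero, dist_zero_right] at h1
  refine h1.trans ?_
  have : (0 : ℝ) ≤ ‖T x‖ := norm_nonneg _
  change (K : ℝ) * ‖T x‖ ≤ (K + 1) * ‖T x‖
  linarith

/-- A compact selfadjoint operator is small off a finite-dimensional subspace. -/
theorem _root_.IsCompactOperator.exists_finiteDimensional_norm_apply_le {K : H →L[ℝ] H}
    (hK : IsCompactOperator K) (hKs : IsSelfAdjoint K) {ε : ℝ} (hε : 0 < ε) :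
    ∃ W : Submodule ℝ H, FiniteDimensional ℝ W ∧ ∀ x ∈ Wᗮ, ‖K x‖ ≤ ε * ‖x‖ := by
  have hcomp := hK.isCompact_closure_image_closedBall (𝕜₁ := ℝ) (f := (K : H →ₗ[ℝ] H)) 1
  obtain ⟨s, hs, hcov⟩ := Metric.totallyBounded_iff.1
    (hcomp.totallyBounded.subset subset_closure) ε hε
  -- `s` is a finite `ε`-net of the image of the unit ball. By selfadjointness `‖K x‖ = ⟨x, K y⟩`
  -- for the unit vector `y` along `K x`, and `x` is orthogonal to the net point near `K y`.
  refine ⟨Submodule.span ℝ s, FiniteDimensional.span_of_finite ℝ hs, fun x hx => ?_⟩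
  by_cases hKx : K x = 0
  · rw [hKx, norm_zero]; positivity
  have hn : 0 < ‖K x‖ := norm_pos_iff.2 hKx
  set y := ‖K x‖⁻¹ • K x with hy
  have hy1 : ‖y‖ = 1 := by rw [hy, norm_smul, norm_inv, norm_norm, inv_mul_cancel₀ hn.ne']
  obtain ⟨w, hw, hwy⟩ := Set.mem_iUnion₂.1 (hcov ⟨y, by simp [hy1], rfl⟩)
  have hwy' : ‖K y - w‖ < ε := by simpa [← dist_eq_norm] using hwy
  have h1 : ‖K x‖ = inner ℝ x (K y) := by
    rw [← inner_apply_comm hKs, hy, real_inner_smul_right, real_inner_self_eq_norm_sq]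
    field_simp
  have h2 : inner ℝ x w = 0 :=
    Submodule.inner_left_of_mem_orthogonal (Submodule.subset_span hw) hx
  calc ‖K x‖ = inner ℝ x (K y - w) := by rw [inner_sub_right, h2, sub_zero, h1]
    _ ≤ ‖x‖ * ‖K y - w‖ := real_inner_le_norm _ _
    _ ≤ ‖x‖ * ε := by gcongr
    _ = _ := mul_comm _ _

theorem BoundedBelowModFinite.add_compact {T K : H →L[ℝ] H} (hT : BoundedBelowModFinite T)
    (hK : IsCompactOperator K) (hKs : IsSelfAdjoint K) : BoundedBelowModFinite (T + K) := by
  obtain ⟨V, hV, δ, hδ, h⟩ := hT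
  obtain ⟨W, hW, hW'⟩ := hK.exists_finiteDimensional_norm_apply_le hKs (half_pos hδ)
  refine ⟨V ⊔ W, inferInstance, δ / 2, half_pos hδ, fun x hx => ?_⟩
  have h1 := h x (Submodule.orthogonal_le le_sup_left hx)
  have h2 := hW' x (Submodule.orthogonal_le le_sup_right hx)
  have h3 : ‖T x‖ ≤ ‖(T + K) x‖ + ‖K x‖ := by
    have : T x = (T + K) x - K x := by simp
    rw [this]; exact norm_sub_le _ _
  linarith

/-- On the range `‖T x‖ ≤ a ‖x‖`, on `Vᗮ` it is at least `(δ - ‖T - T₀‖) ‖x‖`. So the range meets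
`Vᗮ` trivially and projects injectively to `V`. -/
theorem finiteDimensional_range_spectralProjection {T₀ T : H →L[ℝ] H} (hT : IsSelfAdjoint T)
    {V : Submodule ℝ H} [FiniteDimensional ℝ V] {δ a : ℝ} (hV : ∀ x ∈ Vᗮ, δ * ‖x‖ ≤ ‖T₀ x‖)
    (ha : 0 ≤ a) (haδ : a + ‖T - T₀‖ < δ) :
    FiniteDimensional ℝ (spectralProjection T (-a) a).range := by
  refine FiniteDimensional.of_injective ((V.orthogonalProjectionOnto : H →ₗ[ℝ] V) ∘ₗ
    (spectralProjection T (-a) a).range.subtype) ?_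
  rw [injective_iff_map_eq_zero]
  rintro ⟨x, hx⟩ h0
  rw [mem_range_spectralProjection hT (by linarith)] at hx
  have hxV : x ∈ Vᗮ := Submodule.orthogonalProjectionOnto_eq_zero_iff.1 h0
  have h1 := hV x hxV
  have h2 := norm_apply_le_of_mem hT ha hx
  have h3 : ‖T₀ x‖ ≤ ‖T x‖ + ‖T - T₀‖ * ‖x‖ := by
    have : T₀ x = T x - (T - T₀) x := by simp
    rw [this]
    refine (norm_sub_le _ _).trans ?_
    gcongr
    exact ContinuousLinearMap.le_opNorm _ _
  refine Subtype.ext (norm_eq_zero.1 ?_)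
  by_contra hne
  have : 0 < ‖x‖ := lt_of_le_of_ne (norm_nonneg _) (Ne.symm hne)
  nlinarith

/-- Split by `P = χ_{[-b,b]}(T)`. On the finite-dimensional range `T - s` is injective, hence
bounded below; on the kernel of `P` it is bounded below by `b - |s|`. -/
theorem exists_le_norm_apply_sub_of_not_eigenvalue {T : H →L[ℝ] H} (hT : IsSelfAdjoint T) {b s : ℝ}
    (hs : |s| < b) [FiniteDimensional ℝ (spectralProjection T (-b) b).range]
    (hns : ∀ x, spectralProjection T (-b) b x = x → T x = s • x → x = 0) :
    ∃ c > 0, ∀ x, c * ‖x‖ ≤ ‖T x - s • x‖ := by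
  have hb : 0 < b := (abs_nonneg s).trans_lt hs
  set P := spectralProjection T (-b) b with hP
  have hidem : ∀ x, P (P x) = P x := fun x =>
    spectralProjection_apply_apply hT (by linarith) (by linarith) le_rfl le_rfl x
  set A : P.range →ₗ[ℝ] H := ((T : H →ₗ[ℝ] H) - s • LinearMap.id) ∘ₗ P.range.subtype with hA
  have hAinj : Function.Injective A := by
    rw [injective_iff_map_eq_zero]
    rintro ⟨x, hx⟩ h0
    have : T x - s • x = 0 := h0
    exact Subtype.ext (hns x ((mem_range_spectralProjection hT (by linarith)).1 hx)
      (sub_eq_zero.1 this))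
  obtain ⟨K, hK0, hK⟩ := A.injective_iff_antilipschitz.1 hAinj
  have hK' : ∀ x, ‖P x‖ ≤ K * ‖T (P x) - s • P x‖ := fun x => by
    have := hK.le_mul_dist ⟨P x, x, rfl⟩ 0
    rw [dist_zero_right, map_zero, dist_zero_right] at this
    exact this
  have hd : 0 < b - |s| := by linarith
  set D : ℝ := K * ‖P‖ + (1 + ‖P‖) / (b - |s|) with hD
  have hD0 : 0 < D := by positivity
  refine ⟨D⁻¹, by positivity, fun x => ?_⟩
  rw [inv_mul_le_iff₀ hD0]
  set w := T x - s • x with hw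
  have hPw : T (P x) - s • P x = P w := by
    rw [hw, map_sub, map_smul, hP, spectralProjection_apply_self_comm hT (by linarith)]
  have h1 : ‖P x‖ ≤ K * (‖P‖ * ‖w‖) := by
    refine (hK' x).trans ?_
    rw [hPw]
    gcongr
    exact P.le_opNorm w
  have h2 : b * ‖x - P x‖ ≤ ‖T (x - P x)‖ :=
    le_norm_apply_of_apply_eq_zero hT hb.le (by rw [← hP, map_sub, hidem, sub_self])
  have h3 : T (x - P x) = (w - P w) + s • (x - P x) := by
    rw [← hPw, hw, map_sub, smul_sub]; abel
  have h4 : ‖T (x - P x)‖ ≤ (‖w‖ + ‖P‖ * ‖w‖) + |s| * ‖x - P x‖ := by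
    rw [h3]
    refine (norm_add_le _ _).trans (add_le_add ((norm_sub_le _ _).trans ?_) ?_)
    · gcongr; exact P.le_opNorm w
    · rw [norm_smul, Real.norm_eq_abs]
  have h5 : ‖x - P x‖ ≤ (1 + ‖P‖) / (b - |s|) * ‖w‖ := by
    rw [div_mul_eq_mul_div, le_div_iff₀ hd]
    linarith
  calc ‖x‖ = ‖P x + (x - P x)‖ := by rw [add_sub_cancel]
    _ ≤ ‖P x‖ + ‖x - P x‖ := norm_add_le _ _
    _ ≤ K * (‖P‖ * ‖w‖) + (1 + ‖P‖) / (b - |s|) * ‖w‖ := add_le_add h1 h5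
    _ = D * ‖w‖ := by rw [hD]; ring

/-- Near a selfadjoint operator that is bounded below modulo a finite-dimensional subspace, some
spectral projection `χ_{[-a,a]}` is of finite rank and depends continuously on the operator. -/
theorem BoundedBelowModFinite.exists_continuousOn_spectralProjection {T₀ : H →L[ℝ] H}
    (h₀ : BoundedBelowModFinite T₀) (hT₀ : IsSelfAdjoint T₀) :
    ∃ a > 0, ∃ r > 0,
      ContinuousOn (fun T => spectralProjection T (-a) a)
        ({T | IsSelfAdjoint T} ∩ Metric.ball T₀ r) ∧
      ∀ T ∈ {T | IsSelfAdjoint T} ∩ Metric.ball T₀ r,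
        FiniteDimensional ℝ (spectralProjection T (-a) a).range := by
  obtain ⟨V, hV, δ, hδ, hδV⟩ := h₀
  set b := δ / 2 with hb
  have hb0 : 0 < b := half_pos hδ
  have hfin : FiniteDimensional ℝ (spectralProjection T₀ (-b) b).range :=
    finiteDimensional_range_spectralProjection hT₀ hδV hb0.le (by rw [sub_self, norm_zero]; linarith)
  set E := (spectralProjection T₀ (-b) b).range with hE
  have hinv : ∀ x ∈ E, (T₀ : H →ₗ[ℝ] H) x ∈ E := fun x hx => by
    rw [hE, mem_range_spectralProjection hT₀ (by linarith)] at hx ⊢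
    change spectralProjection T₀ (-b) b (T₀ x) = T₀ x
    rw [spectralProjection_apply_self_comm hT₀ (by linarith), hx]
  set A : Module.End ℝ E := (T₀ : H →ₗ[ℝ] H).restrict hinv
  have hF : Set.Finite {μ | A.HasEigenvalue μ} := Module.End.finite_hasEigenvalue A
  have hF2 : Set.Finite ({μ | A.HasEigenvalue μ} ∪ Neg.neg ⁻¹' {μ | A.HasEigenvalue μ}) :=
    hF.union (hF.preimage neg_injective.injOn)
  -- Only finitely many `a` are excluded by requiring that neither `a` nor `-a` be an eigenvalue of
  -- `T₀` on `E`.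
  obtain ⟨a, ha, haF⟩ := (Set.Ioo_infinite hb0).exists_notMem_finite hF2
  rw [Set.mem_union, not_or] at haF
  have hne : ∀ s, ¬ A.HasEigenvalue s →
      ∀ x, spectralProjection T₀ (-b) b x = x → T₀ x = s • x → x = 0 := fun s hs x hx hxs => by
    by_contra hx0
    have hxE : x ∈ E := (mem_range_spectralProjection hT₀ (by linarith)).2 hx
    refine hs (Module.End.hasEigenvalue_of_hasEigenvector (x := ⟨x, hxE⟩) ⟨?_, fun h => hx0 ?_⟩)
    · rw [Module.End.mem_eigenspace_iff]
      exact Subtype.ext hxs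
    · exact congrArg Subtype.val h
  obtain ⟨c₁, hc₁, h₁⟩ := exists_le_norm_apply_sub_of_not_eigenvalue hT₀
    (by rw [abs_of_pos ha.1]; exact ha.2) (hne a haF.1)
  obtain ⟨c₂, hc₂, h₂⟩ := exists_le_norm_apply_sub_of_not_eigenvalue hT₀
    (by rw [abs_neg, abs_of_pos ha.1]; exact ha.2) (hne (-a) haF.2)
  set c := min c₁ c₂
  have hc : 0 < c := lt_min hc₁ hc₂
  -- Radius `c/2` preserves the gaps at `±a`; radius `b/2` gives `a + ‖T - T₀‖ < 3b/2 < δ` and hence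
  -- finite rank.
  refine ⟨a, ha.1, min (c / 2) (b / 2), by positivity, ?_, fun T hT => ?_⟩
  · refine (continuousOn_spectralProjection ha.1 hc (fun x => ?_) fun x => ?_).mono
      (Set.inter_subset_inter_right _ (Metric.ball_subset_ball (min_le_left _ _)))
    · exact (mul_le_mul_of_nonneg_right (min_le_left _ _) (norm_nonneg _)).trans (h₁ x)
    · exact (mul_le_mul_of_nonneg_right (min_le_right _ _) (norm_nonneg _)).trans (h₂ x)
  · have h3 := hT.2
    rw [mem_ball_iff_norm] at h3
    have h4 := h3.trans_le (min_le_right _ _)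
    exact finiteDimensional_range_spectralProjection hT.1 hδV ha.1.le (by linarith [ha.2])

end SpectralProjections

/-! ### Classes of invariant subspaces in `RO(G)` -/

section Classes

set_option linter.unusedSectionVars false

variable {G : Type v} [Group G] [TopologicalSpace G]
variable {H : Type u} [NormedAddCommGroup H] [InnerProductSpace ℝ H] [CompleteSpace H]
variable [DistribMulAction G H] [SMulCommClass G ℝ H] [ContinuousSMul G H]

/-- A linear map commuting with the action of `G`. -/
def IsEquivariant (G : Type v) [Group G] [DistribMulAction G H] (T : H →L[ℝ] H) : Prop :=
  ∀ (g : G) (x : H), T (g • x) = g • T x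

theorem IsEquivariant.sub {T S : H →L[ℝ] H} (hT : IsEquivariant G T) (hS : IsEquivariant G S) :
    IsEquivariant G (T - S) := fun g x => by
  rw [sub_apply, sub_apply, hT, hS, smul_sub]

theorem IsEquivariant.spectralProjection {T : H →L[ℝ] H} (hT : IsSelfAdjoint T)
    (hG : IsEquivariant G T) {a b : ℝ} (hab : a ≤ b) :
    IsEquivariant G (spectralProjection T a b) := fun g x =>
  spectralProjection_apply_comm hT hab (A := DistribSMul.toAddMonoidHom H g)
    (fun c x => smul_comm g c x) (continuous_const_smul g) (hG g) x

theorem IsEquivariant.smul_mem_range {P : H →L[ℝ] H} (hP : IsEquivariant G P) (g : G) :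
    ∀ x ∈ P.range, g • x ∈ P.range := by
  rintro _ ⟨y, rfl⟩
  exact ⟨g • y, hP g y⟩

theorem subspaceClass_eq_of_equiv {E F : Submodule ℝ H} [hE : FiniteDimensional ℝ E]
    [hF : FiniteDimensional ℝ F] (hEG : ∀ (g : G), ∀ x ∈ E, g • x ∈ E)
    (hFG : ∀ (g : G), ∀ x ∈ F, g • x ∈ F) (e : E ≃ₗ[ℝ] F)
    (he : ∀ (g : G) (x : E), (e ⟨g • (x : H), hEG g x x.2⟩ : H) = g • (e x : H)) :
    subspaceClass G E = subspaceClass G F := by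
  unfold subspaceClass
  rw [dif_pos ⟨hE, hEG⟩, dif_pos ⟨hF, hFG⟩]
  unfold RO.mk
  congr 1
  refine Quotient.sound ⟨Representation.Equiv.mk e fun g => ?_⟩
  exact LinearMap.ext fun x => Subtype.ext (he g x)

theorem subspaceClass_eq_add {E E₁ E₂ : Submodule ℝ H} [hE : FiniteDimensional ℝ E]
    [hE₁ : FiniteDimensional ℝ E₁] [hE₂ : FiniteDimensional ℝ E₂]
    (hG : ∀ (g : G), ∀ x ∈ E, g • x ∈ E) (hG₁ : ∀ (g : G), ∀ x ∈ E₁, g • x ∈ E₁)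
    (hG₂ : ∀ (g : G), ∀ x ∈ E₂, g • x ∈ E₂) (e : (E₁ × E₂) ≃ₗ[ℝ] E)
    (he : ∀ x, (e x : H) = x.1 + x.2) :
    subspaceClass G E = subspaceClass G E₁ + subspaceClass G E₂ := by
  unfold subspaceClass
  rw [dif_pos ⟨hE, hG⟩, dif_pos ⟨hE₁, hG₁⟩, dif_pos ⟨hE₂, hG₂⟩]
  unfold RO.mk
  refine (congrArg _ ?_).trans (map_add Algebra.GrothendieckAddGroup.of _ _)
  refine Eq.symm (Quotient.sound (s := RealRep.setoid G) (a := (subspaceRep G E₁ hE₁ hG₁).sum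
    (subspaceRep G E₂ hE₂ hG₂)) ⟨Representation.Equiv.mk e fun g => ?_⟩)
  refine LinearMap.ext fun x => Subtype.ext ?_
  refine (he _).trans ?_
  let y : E₁ × E₂ := x
  change g • (y.1 : H) + g • (y.2 : H) = g • (e y : H)
  rw [he, smul_add]

/-- If `D` is a projection onto a subspace of the range of `C`, the class of the range of `C`
splits. -/
theorem subspaceClass_range_eq_add {C D : H →L[ℝ] H} (hC : IsEquivariant G C)
    (hD : IsEquivariant G D) (hCC : ∀ x, C (C x) = C x) (hCD : ∀ x, C (D x) = D x)
    (hDC : ∀ x, D (C x) = D x) (hDD : ∀ x, D (D x) = D x) (hfin : FiniteDimensional ℝ C.range) :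
    subspaceClass G C.range = subspaceClass G D.range + subspaceClass G (C - D).range := by
  have hle : D.range ≤ C.range := by
    rintro _ ⟨y, rfl⟩
    exact ⟨D y, hCD y⟩
  have hle' : (C - D).range ≤ C.range := by
    rintro _ ⟨y, rfl⟩
    exact ⟨C y - D y, by simp [hCC, hCD]⟩
  have : FiniteDimensional ℝ D.range := Submodule.finiteDimensional_of_le hle
  have : FiniteDimensional ℝ (C - D).range := Submodule.finiteDimensional_of_le hle'
  have hDfix : ∀ x : D.range, D x = x := by
    rintro ⟨_, y, rfl⟩
    exact hDD y
  have hD0 : ∀ x : (C - D).range, D x = 0 := by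
    rintro ⟨_, y, rfl⟩
    change D (C y - D y) = 0
    rw [map_sub, hDC, hDD, sub_self]
  refine subspaceClass_eq_add hC.smul_mem_range hD.smul_mem_range (hC.sub hD).smul_mem_range
    (LinearEquiv.ofBijective
      ((Submodule.inclusion hle).coprod (Submodule.inclusion hle')) ⟨?_, ?_⟩) fun x => rfl
  · rw [injective_iff_map_eq_zero]
    rintro ⟨x, y⟩ h
    have h' : (x : H) + y = 0 := congrArg Subtype.val h
    have hx : (x : H) = 0 := by
      have := congrArg D h'
      rwa [map_add, hDfix, hD0, add_zero, map_zero] at this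
    have hy : (y : H) = 0 := by rwa [hx, zero_add] at h'
    exact Prod.ext (Subtype.ext hx) (Subtype.ext hy)
  · rintro ⟨_, y, rfl⟩
    exact ⟨(⟨D y, y, rfl⟩, ⟨C y - D y, y, rfl⟩), Subtype.ext (add_sub_cancel _ _)⟩

/-- If `Q` is injective on the range of `P`, and the range of `Q` has no larger dimension, then both
ranges are isomorphic representations. -/
theorem subspaceClass_range_eq_of_injOn {P Q : H →L[ℝ] H} (hP : IsEquivariant G P)
    (hQ : IsEquivariant G Q) [hPf : FiniteDimensional ℝ P.range] [hQf : FiniteDimensional ℝ Q.range]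
    (hinj : ∀ x ∈ P.range, Q x = 0 → x = 0)
    (hdim : Module.finrank ℝ Q.range ≤ Module.finrank ℝ P.range) :
    subspaceClass G P.range = subspaceClass G Q.range := by
  set A : P.range →ₗ[ℝ] Q.range :=
    (Q : H →ₗ[ℝ] H).rangeRestrict ∘ₗ P.range.subtype with hA
  have hAinj : Function.Injective A := by
    rw [injective_iff_map_eq_zero]
    rintro ⟨x, hx⟩ h
    exact Subtype.ext (hinj x hx (congrArg Subtype.val h))
  have heq := le_antisymm (LinearMap.finrank_le_finrank_of_injective hAinj) hdim
  refine subspaceClass_eq_of_equiv hP.smul_mem_range hQ.smul_mem_range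
    (LinearEquiv.ofBijective A ⟨hAinj,
      (LinearMap.injective_iff_surjective_of_finrank_eq_finrank heq).1 hAinj⟩) fun g x => hQ g x

end Classes

/-! ### Local constancy of the class of the spectral subspace of `(a, b]` -/

section LocalConstancy

set_option linter.unusedSectionVars false

variable (G : Type v) [Group G] [TopologicalSpace G]
variable {H : Type u} [NormedAddCommGroup H] [InnerProductSpace ℝ H] [CompleteSpace H]
variable [DistribMulAction G H] [SMulCommClass G ℝ H] [ContinuousSMul G H]

/-- The class `[E(T,[0,a])]`. -/
def spectralClass (T : H →L[ℝ] H) (a : ℝ) : RO.{u, v} G :=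
  subspaceClass G (spectralSubspace T 0 a)

/-- The projection onto the spectral subspace of `(a, b]`. -/
def positivePart (T : H →L[ℝ] H) (a b : ℝ) : H →L[ℝ] H :=
  spectralProjection T 0 b - spectralProjection T 0 a

/-- The projection onto the spectral subspace of `[-b, -a) ∪ (a, b]`. -/
def annulusPart (T : H →L[ℝ] H) (a b : ℝ) : H →L[ℝ] H :=
  spectralProjection T (-b) b - spectralProjection T (-a) a

variable {G}

theorem finiteDimensional_range_of_mul_eq {P Q : H →L[ℝ] H} (h : ∀ x, P (Q x) = Q x)
    (hP : FiniteDimensional ℝ P.range) : FiniteDimensional ℝ Q.range := by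
  refine Submodule.finiteDimensional_of_le (S₂ := P.range) ?_
  rintro _ ⟨y, rfl⟩
  exact ⟨Q y, h y⟩

theorem spectralClass_eq_add {T : H →L[ℝ] H} (hT : IsSelfAdjoint T) (hG : IsEquivariant G T)
    {a b : ℝ} (ha : 0 ≤ a) (hab : a ≤ b)
    (hfin : FiniteDimensional ℝ (spectralProjection T (-b) b).range) :
    spectralClass G T b = spectralClass G T a + subspaceClass G (positivePart T a b).range := by
  have hb := ha.trans hab
  refine subspaceClass_range_eq_add (hG.spectralProjection hT hb) (hG.spectralProjection hT ha)
    (spectralProjection_apply_apply hT hb hb le_rfl le_rfl)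
    (spectralProjection_apply_apply hT hb ha le_rfl hab)
    (spectralProjection_apply_apply' hT hb ha le_rfl hab)
    (spectralProjection_apply_apply hT ha ha le_rfl le_rfl) ?_
  exact finiteDimensional_range_of_mul_eq
    (spectralProjection_apply_apply hT (by linarith) hb (by linarith) le_rfl) hfin

/-- The algebra of the four projections `χ_{[-b,b]}`, `χ_{[-a,a]}`, `χ_{[0,b]}`, `χ_{[0,a]}`. -/
theorem annulus_facts {T : H →L[ℝ] H} (hT : IsSelfAdjoint T) {a b : ℝ} (ha : 0 ≤ a)
    (hab : a ≤ b) :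
    (∀ x, annulusPart T a b (annulusPart T a b x) = annulusPart T a b x) ∧
    (∀ x, positivePart T a b (positivePart T a b x) = positivePart T a b x) ∧
    (∀ x, annulusPart T a b (positivePart T a b x) = positivePart T a b x) ∧
    (∀ x, positivePart T a b (annulusPart T a b x) = positivePart T a b x) ∧
    (∀ x, positivePart T a b x = x → a * ‖x‖ ^ 2 ≤ inner ℝ (T x) x) ∧
    (∀ x, annulusPart T a b x = x → positivePart T a b x = 0 →
      inner ℝ (T x) x ≤ -a * ‖x‖ ^ 2) := by
  have hb := ha.trans hab
  have hb' : -b ≤ b := by linarith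
  have ha' : -a ≤ a := by linarith
  have AA := spectralProjection_apply_apply hT hb' hb' le_rfl le_rfl
  have AB := spectralProjection_apply_apply hT hb' ha' (by linarith) hab
  have BA := spectralProjection_apply_apply' hT hb' ha' (by linarith) hab
  have BB := spectralProjection_apply_apply hT ha' ha' le_rfl le_rfl
  have AC := spectralProjection_apply_apply hT hb' hb (by linarith) le_rfl
  have CA := spectralProjection_apply_apply' hT hb' hb (by linarith) le_rfl
  have AD := spectralProjection_apply_apply hT hb' ha (by linarith) hab
  have DA := spectralProjection_apply_apply' hT hb' ha (by linarith) hab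
  have BD := spectralProjection_apply_apply hT ha' ha (by linarith) le_rfl
  have DB := spectralProjection_apply_apply' hT ha' ha (by linarith) le_rfl
  have CC := spectralProjection_apply_apply hT hb hb le_rfl le_rfl
  have CD := spectralProjection_apply_apply hT hb ha le_rfl hab
  have DC := spectralProjection_apply_apply' hT hb ha le_rfl hab
  have DD := spectralProjection_apply_apply hT ha ha le_rfl le_rfl
  have hinter : Set.Icc (-a) a ∩ Set.Icc 0 b = Set.Icc 0 a := by
    rw [Set.Icc_inter_Icc, max_eq_right (by linarith), min_eq_left hab]
  have BC : ∀ x, spectralProjection T (-a) a (spectralProjection T 0 b x) =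
      spectralProjection T 0 a x :=
    spectralProjection_apply_apply_of_inter hT ha' hb ha hinter
  have CB : ∀ x, spectralProjection T 0 b (spectralProjection T (-a) a x) =
      spectralProjection T 0 a x :=
    spectralProjection_apply_apply_of_inter hT hb ha' ha (Set.inter_comm _ _ ▸ hinter)
  have hpos : ∀ x, positivePart T a b x = spectralProjection T 0 b x - spectralProjection T 0 a x :=
    fun x => rfl
  have hann : ∀ x, annulusPart T a b x =
      spectralProjection T (-b) b x - spectralProjection T (-a) a x := fun x => rfl
  refine ⟨fun x => ?_, fun x => ?_, fun x => ?_, fun x => ?_, fun x hx => ?_, fun x hx hx' => ?_⟩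
  · simp only [hann, map_sub, AA, AB, BA, BB]; abel
  · simp only [hpos, map_sub, CC, CD, DC, DD]; abel
  · simp only [hpos, hann, map_sub, AC, AD, BC, BD]; abel
  · simp only [hpos, hann, map_sub, CA, CB, DA, DB]; abel
  · refine le_inner_of_mem_of_apply_eq_zero hT ha hab ?_ ?_
    · rw [← hx, hpos, map_sub, CC, CD]
    · rw [← hx, hpos, map_sub, DC, DD, sub_self]
  · have hAx : spectralProjection T (-b) b x = x := by rw [← hx, hann, map_sub, AA, AB]
    have hBx : spectralProjection T (-a) a x = 0 := by
      rw [← hx, hann, map_sub, BA, BB, sub_self]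
    refine inner_le_of_mem_of_apply_eq_zero hT ha hab hAx hBx ?_
    have : spectralProjection T 0 a x = 0 := by rw [← DB, hBx, map_zero]
    rw [hpos, this, sub_zero] at hx'
    exact hx'

/-- A vector fixed by `P` and killed by `Q` is fixed by `P - Q`, which has norm below 1. So `Q` is
injective on the range of `P`. -/
theorem finrank_range_le_of_norm_sub_lt {P Q : H →L[ℝ] H} (hP : ∀ x, P (P x) = P x)
    (hlt : ‖P - Q‖ < 1) [FiniteDimensional ℝ Q.range] :
    Module.finrank ℝ P.range ≤ Module.finrank ℝ Q.range := by
  refine LinearMap.finrank_le_finrank_of_injective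
    (f := (Q : H →ₗ[ℝ] H).rangeRestrict ∘ₗ P.range.subtype) ?_
  rw [injective_iff_map_eq_zero]
  rintro ⟨_, y, rfl⟩ h
  have h0 : Q (P y) = 0 := congrArg Subtype.val h
  have h1 : (P - Q) (P y) = P y := by rw [sub_apply, hP, h0, sub_zero]
  have h2 := (P - Q).le_opNorm (P y)
  rw [h1] at h2
  refine Subtype.ext (norm_eq_zero.1 ?_)
  change ‖P y‖ = 0
  by_contra hne
  have : 0 < ‖P y‖ := lt_of_le_of_ne (norm_nonneg _) (Ne.symm hne)
  nlinarith

theorem finrank_range_add {Q P : H →L[ℝ] H} (hQQ : ∀ x, Q (Q x) = Q x) (hPP : ∀ x, P (P x) = P x)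
    (hQP : ∀ x, Q (P x) = P x) (hPQ : ∀ x, P (Q x) = P x) [FiniteDimensional ℝ Q.range] :
    Module.finrank ℝ P.range + Module.finrank ℝ (Q - P).range = Module.finrank ℝ Q.range := by
  have hle : P.range ≤ Q.range := by
    rintro _ ⟨y, rfl⟩
    exact ⟨P y, hQP y⟩
  have hle' : (Q - P).range ≤ Q.range := by
    rintro _ ⟨y, rfl⟩
    exact ⟨Q y - P y, by simp [hQQ, hQP]⟩
  have : FiniteDimensional ℝ P.range := Submodule.finiteDimensional_of_le hle
  have : FiniteDimensional ℝ (Q - P).range := Submodule.finiteDimensional_of_le hle'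
  have hsup : P.range ⊔ (Q - P).range = Q.range := by
    refine le_antisymm (sup_le hle hle') ?_
    rintro _ ⟨y, rfl⟩
    exact Submodule.mem_sup.2 ⟨P y, ⟨y, rfl⟩, Q y - P y, ⟨y, rfl⟩, add_sub_cancel _ _⟩
  have hinf : P.range ⊓ (Q - P).range = ⊥ := by
    rw [eq_bot_iff]
    rintro _ ⟨⟨y, rfl⟩, ⟨z, hz⟩⟩
    have hz' : Q z - P z = P y := hz
    have := congrArg P hz'
    rw [map_sub, hPQ, hPP, sub_self, hPP] at this
    exact this.symm
  have := Submodule.finrank_sup_add_finrank_inf_eq P.range (Q - P).range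
  rw [hsup, hinf, finrank_bot, add_zero] at this
  exact this.symm

/-- Compare the forms of the compressions `Q T Q` and `Q₀ T₀ Q₀` at `x`. In the first case the `T₀`
form is at least `a ‖x‖²` while the `T` form is nonpositive; in the second the signs are reversed. A
difference of norm less than `a` leaves only `x = 0`. -/
theorem positivePart_apply_eq_zero_imp {T T₀ : H →L[ℝ] H} (hT : IsSelfAdjoint T)
    (hT₀ : IsSelfAdjoint T₀) {a b : ℝ} (ha : 0 < a) (hab : a ≤ b)
    (hclose : ‖annulusPart T a b * T * annulusPart T a b -
      annulusPart T₀ a b * T₀ * annulusPart T₀ a b‖ < a) {x : H} :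
    (positivePart T₀ a b x = x → positivePart T a b x = 0 → x = 0) ∧
    (annulusPart T₀ a b x = x → positivePart T₀ a b x = 0 →
      annulusPart T a b x = positivePart T a b x → x = 0) := by
  obtain ⟨QQ, PP, QP, PQ, hpos, hneg⟩ := annulus_facts hT ha.le hab
  obtain ⟨QQ₀, PP₀, QP₀, PQ₀, hpos₀, hneg₀⟩ := annulus_facts hT₀ ha.le hab
  have hQsym : ∀ {S : H →L[ℝ] H}, IsSelfAdjoint S → IsSelfAdjoint (annulusPart S a b) :=
    fun hS => (isSelfAdjoint_spectralProjection hS (by linarith)).sub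
      (isSelfAdjoint_spectralProjection hS (by linarith))
  have hform : ∀ {S : H →L[ℝ] H}, IsSelfAdjoint S →
      inner ℝ ((annulusPart S a b * S * annulusPart S a b) x) x =
        inner ℝ (S (annulusPart S a b x)) (annulusPart S a b x) := fun hS => by
    rw [mul_apply_eq_comp, mul_apply_eq_comp, inner_apply_comm (hQsym hS)]
  have hdiff : |inner ℝ (T (annulusPart T a b x)) (annulusPart T a b x) -
      inner ℝ (T₀ (annulusPart T₀ a b x)) (annulusPart T₀ a b x)| ≤
      ‖annulusPart T a b * T * annulusPart T a b -
        annulusPart T₀ a b * T₀ * annulusPart T₀ a b‖ * ‖x‖ ^ 2 := by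
    rw [← hform hT, ← hform hT₀, ← inner_sub_left, ← sub_apply]
    refine (abs_real_inner_le_norm _ _).trans ?_
    rw [pow_two, ← mul_assoc]
    gcongr
    exact ContinuousLinearMap.le_opNorm _ _
  rw [abs_le] at hdiff
  have hzero : a * ‖x‖ ^ 2 ≤ ‖annulusPart T a b * T * annulusPart T a b -
      annulusPart T₀ a b * T₀ * annulusPart T₀ a b‖ * ‖x‖ ^ 2 → x = 0 := fun h => by
    rw [← norm_eq_zero]
    by_contra hne
    have : 0 < ‖x‖ ^ 2 := by positivity
    nlinarith
  have hnn : 0 ≤ a * ‖annulusPart T a b x‖ ^ 2 := by positivity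
  constructor
  · intro hx hx'
    have h1 := hpos₀ x hx
    have hQx : annulusPart T₀ a b x = x := by rw [← hx, QP₀]
    have h2 := hneg (annulusPart T a b x) (QQ x) (by rw [PQ, hx'])
    rw [hQx] at hdiff
    exact hzero (by linarith)
  · intro hx hx' hxx
    have h1 := hneg₀ x hx hx'
    have h2 := hpos (annulusPart T a b x) (by rw [hxx, PP])
    rw [hx] at hdiff
    exact hzero (by linarith)

/-- Positive and negative parts of `T₀` inject into those of `T`, while the total rank for `T` is at
most that for `T₀`. So the ranks agree, and the equivariant injection of positive parts is an
isomorphism. -/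
theorem subspaceClass_positivePart_eq {T T₀ : H →L[ℝ] H} (hT : IsSelfAdjoint T)
    (hT₀ : IsSelfAdjoint T₀) (hG : IsEquivariant G T) (hG₀ : IsEquivariant G T₀) {a b : ℝ}
    (ha : 0 < a) (hab : a ≤ b) [FiniteDimensional ℝ (spectralProjection T (-b) b).range]
    [FiniteDimensional ℝ (spectralProjection T₀ (-b) b).range]
    (hclose : ‖annulusPart T a b * T * annulusPart T a b -
      annulusPart T₀ a b * T₀ * annulusPart T₀ a b‖ < a)
    (hclose' : ‖annulusPart T a b - annulusPart T₀ a b‖ < 1) :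
    subspaceClass G (positivePart T₀ a b).range = subspaceClass G (positivePart T a b).range := by
  have hb := ha.le.trans hab
  obtain ⟨QQ, PP, QP, PQ, -, -⟩ := annulus_facts hT ha.le hab
  obtain ⟨QQ₀, PP₀, QP₀, PQ₀, -, -⟩ := annulus_facts hT₀ ha.le hab
  have hfinQ : ∀ {S : H →L[ℝ] H}, IsSelfAdjoint S →
      FiniteDimensional ℝ (spectralProjection S (-b) b).range →
      FiniteDimensional ℝ (annulusPart S a b).range := fun hS hf => by
    refine finiteDimensional_range_of_mul_eq (fun x => ?_) hf
    change spectralProjection _ (-b) b (spectralProjection _ (-b) b x -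
      spectralProjection _ (-a) a x) = _
    rw [map_sub, spectralProjection_apply_apply hS (by linarith) (by linarith) le_rfl le_rfl,
      spectralProjection_apply_apply hS (by linarith) (by linarith) (by linarith) hab]
    rfl
  have hQf := hfinQ hT inferInstance
  have hQf₀ := hfinQ hT₀ inferInstance
  have hPf := finiteDimensional_range_of_mul_eq QP hQf
  have hPf₀ := finiteDimensional_range_of_mul_eq QP₀ hQf₀
  have hNf := finiteDimensional_range_of_mul_eq (P := annulusPart T a b)
    (Q := annulusPart T a b - positivePart T a b) (fun x => by simp [QQ, QP]) hQf
  have hNf₀ := finiteDimensional_range_of_mul_eq (P := annulusPart T₀ a b)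
    (Q := annulusPart T₀ a b - positivePart T₀ a b) (fun x => by simp [QQ₀, QP₀]) hQf₀
  have hsum := finrank_range_add QQ PP QP PQ
  have hsum₀ := finrank_range_add QQ₀ PP₀ QP₀ PQ₀
  have hle := finrank_range_le_of_norm_sub_lt QQ hclose'
  have hN : Module.finrank ℝ (annulusPart T₀ a b - positivePart T₀ a b).range ≤
      Module.finrank ℝ (annulusPart T a b - positivePart T a b).range := by
    refine LinearMap.finrank_le_finrank_of_injective
      (f := ((annulusPart T a b - positivePart T a b : H →L[ℝ] H) : H →ₗ[ℝ] H).rangeRestrict ∘ₗ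
        (annulusPart T₀ a b - positivePart T₀ a b).range.subtype) ?_
    rw [injective_iff_map_eq_zero]
    rintro ⟨_, y, rfl⟩ h
    have h0 := congrArg Subtype.val h
    refine Subtype.ext ((positivePart_apply_eq_zero_imp hT hT₀ ha hab hclose).2 ?_ ?_
      (sub_eq_zero.1 h0))
    · simp [QQ₀, QP₀]
    · simp [PQ₀, PP₀]
  have hequiv : ∀ {S : H →L[ℝ] H}, IsSelfAdjoint S → IsEquivariant G S →
      IsEquivariant G (positivePart S a b) := fun hS hSG =>
    (hSG.spectralProjection hS hb).sub (hSG.spectralProjection hS ha.le)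
  refine subspaceClass_range_eq_of_injOn (hequiv hT₀ hG₀) (hequiv hT hG) ?_ (by omega)
  rintro _ ⟨y, rfl⟩ hx
  exact (positivePart_apply_eq_zero_imp hT hT₀ ha hab hclose).1 (PP₀ y) hx

/-- The family `T` has a continuous family of finite rank spectral projections `χ_{[-a,a]}`
on `s`. -/
def AdmissibleOn {Y : Type*} [TopologicalSpace Y] (T : Y → H →L[ℝ] H) (a : ℝ) (s : Set Y) : Prop :=
  ContinuousOn (fun y => spectralProjection (T y) (-a) a) s ∧
    ∀ y ∈ s, FiniteDimensional ℝ (spectralProjection (T y) (-a) a).range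

theorem AdmissibleOn.mono {Y : Type*} [TopologicalSpace Y] {T : Y → H →L[ℝ] H} {a : ℝ}
    {s t : Set Y} (h : AdmissibleOn T a t) (hst : s ⊆ t) : AdmissibleOn T a s :=
  ⟨h.1.mono hst, fun y hy => h.2 y (hst hy)⟩

theorem isLocallyConstant_subspaceClass_positivePart {Y : Type*} [TopologicalSpace Y]
    {T : Y → H →L[ℝ] H} {s : Set Y} (hTc : Continuous T) (hT : ∀ y, IsSelfAdjoint (T y))
    (hG : ∀ y, IsEquivariant G (T y)) {a b : ℝ} (ha : 0 < a) (hab : a ≤ b)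
    (hAa : AdmissibleOn T a s) (hAb : AdmissibleOn T b s) :
    IsLocallyConstant (fun w : s => subspaceClass G (positivePart (T w) a b).range) := by
  rw [IsLocallyConstant.iff_eventually_eq]
  intro w
  have hQ : Continuous fun w : s => annulusPart (T w) a b :=
    (continuousOn_iff_continuous_domRestrict.1 hAb.1).sub
      (continuousOn_iff_continuous_domRestrict.1 hAa.1)
  have hQT : Continuous fun w : s => annulusPart (T w) a b * T w * annulusPart (T w) a b :=
    (hQ.mul (hTc.comp continuous_subtype_val)).mul hQ
  filter_upwards [Metric.continuous_iff'.1 hQT w a ha, Metric.continuous_iff'.1 hQ w 1 one_pos]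
    with w' h1 h2
  rw [dist_eq_norm] at h1 h2
  have := hAb.2 w w.2
  have := hAb.2 w' w'.2
  exact (subspaceClass_positivePart_eq (hT w') (hT w) (hG w') (hG w) ha hab h1 h2).symm

theorem spectralClass_sub_eq_of_le {Y : Type*} [TopologicalSpace Y] {T : Y → H →L[ℝ] H} {s : Set Y}
    (hs : IsPreconnected s) (hTc : Continuous T) (hT : ∀ y, IsSelfAdjoint (T y))
    (hG : ∀ y, IsEquivariant G (T y)) {a b : ℝ} (ha : 0 < a) (hab : a ≤ b)
    (hAa : AdmissibleOn T a s) (hAb : AdmissibleOn T b s) {y z : Y} (hy : y ∈ s) (hz : z ∈ s) :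
    spectralClass G (T y) b - spectralClass G (T y) a =
      spectralClass G (T z) b - spectralClass G (T z) a := by
  have : PreconnectedSpace s := isPreconnected_iff_preconnectedSpace.1 hs
  have hloc := (isLocallyConstant_subspaceClass_positivePart hTc hT hG ha hab hAa hAb
    ).apply_eq_of_preconnectedSpace ⟨y, hy⟩ ⟨z, hz⟩
  rw [spectralClass_eq_add (hT y) (hG y) ha.le hab (hAb.2 y hy),
    spectralClass_eq_add (hT z) (hG z) ha.le hab (hAb.2 z hz), add_sub_cancel_left,
    add_sub_cancel_left]
  exact hloc

/-- The change of `[E(T,[0,a])]` along a preconnected set does not depend on the admissible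
number `a`. -/
theorem spectralClass_sub_eq {Y : Type*} [TopologicalSpace Y] {T : Y → H →L[ℝ] H} {s : Set Y}
    (hs : IsPreconnected s) (hTc : Continuous T) (hT : ∀ y, IsSelfAdjoint (T y))
    (hG : ∀ y, IsEquivariant G (T y)) {a b : ℝ} (ha : 0 < a) (hb : 0 < b)
    (hAa : AdmissibleOn T a s) (hAb : AdmissibleOn T b s) {y z : Y} (hy : y ∈ s) (hz : z ∈ s) :
    spectralClass G (T z) a - spectralClass G (T y) a =
      spectralClass G (T z) b - spectralClass G (T y) b := by
  rcases le_total a b with h | h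
  · have := spectralClass_sub_eq_of_le hs hTc hT hG ha h hAa hAb hy hz
    rw [sub_eq_sub_iff_add_eq_add] at this ⊢
    rw [add_comm, ← this, add_comm]
  · have := spectralClass_sub_eq_of_le hs hTc hT hG hb h hAb hAa hy hz
    rw [sub_eq_sub_iff_add_eq_add] at this ⊢
    rw [← this, add_comm]

end LocalConstancy

/-! ### Independence of the partition -/

section Partitions

set_option linter.unusedSectionVars false

theorem sum_succ_sub_castSucc {A : Type*} [AddCommGroup A] {n : ℕ} (f : Fin (n + 1) → A) :
    ∑ i : Fin n, (f i.succ - f i.castSucc) = f (Fin.last n) - f 0 := by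
  have h1 := Fin.sum_univ_succ f
  have h2 := Fin.sum_univ_castSucc f
  rw [Finset.sum_sub_distrib, sub_eq_sub_iff_add_eq_add, add_comm _ (f 0), ← h1, h2, add_comm]

/-- The increment of `c` from `min x s` to `min x t`, as an increment between clamped points. -/
theorem apply_min_sub_apply_min {I A : Type*} [LinearOrder I] [AddCommGroup A] (c : I → A)
    {s t : I} (hst : s ≤ t) (x : I) :
    c (min x t) - c (min x s) = c (max s (min x t)) - c s := by
  rcases le_total x s with h | h
  · rw [min_eq_left h, min_eq_left (h.trans hst), max_eq_left h, sub_self, sub_self]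
  · rw [min_eq_right h, max_eq_right (le_min h hst)]

variable {G : Type v} [Group G] [TopologicalSpace G]
variable {H : Type u} [NormedAddCommGroup H] [InnerProductSpace ℝ H] [CompleteSpace H]
variable [DistribMulAction G H] [SMulCommClass G ℝ H] [ContinuousSMul G H]

/-- The partial sums of the spectral flow along a partition. -/
def AdmissiblePartition.partialFlow {L : C(unitInterval, FS G H)} (D : AdmissiblePartition L)
    (x : unitInterval) : RO.{u, v} G :=
  ∑ i : Fin D.N, (spectralClass G (L (min x (D.t i.succ)) : H →L[ℝ] H) (D.a i) -
    spectralClass G (L (min x (D.t i.castSucc)) : H →L[ℝ] H) (D.a i))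

theorem AdmissiblePartition.partialFlow_one_sub {L : C(unitInterval, FS G H)}
    (D : AdmissiblePartition L) : D.partialFlow 1 - D.partialFlow 0 = D.flow := by
  have h0 : D.partialFlow 0 = 0 := by
    refine Finset.sum_eq_zero fun i _ => ?_
    rw [min_eq_left unitInterval.nonneg', min_eq_left unitInterval.nonneg', sub_self]
  rw [h0, sub_zero]
  refine Finset.sum_congr rfl fun i _ => ?_
  rw [min_eq_right unitInterval.le_one', min_eq_right unitInterval.le_one']
  rfl

/-- Only the overlap of `[p, q]` with each interval of `D` contributes. Both `D.a i` and `b` are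
admissible there, so `b` may replace `D.a i`, and the sum telescopes. This avoids forming a common
refinement of two partitions. -/
theorem AdmissiblePartition.partialFlow_sub {L : C(unitInterval, FS G H)}
    (D : AdmissiblePartition L) {p q : unitInterval} (hpq : p ≤ q) {b : ℝ} (hb : 0 < b)
    (hadm : AdmissibleOn (fun s => (L s : H →L[ℝ] H)) b (Set.Icc p q)) :
    D.partialFlow q - D.partialFlow p =
      spectralClass G (L q : H →L[ℝ] H) b - spectralClass G (L p : H →L[ℝ] H) b := by
  set c : ℝ → unitInterval → RO.{u, v} G := fun a s => spectralClass G (L s : H →L[ℝ] H) a with hc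
  have hterm : ∀ i : Fin D.N,
      (c (D.a i) (min q (D.t i.succ)) - c (D.a i) (min q (D.t i.castSucc))) -
        (c (D.a i) (min p (D.t i.succ)) - c (D.a i) (min p (D.t i.castSucc))) =
      (c b (min q (D.t i.succ)) - c b (min q (D.t i.castSucc))) -
        (c b (min p (D.t i.succ)) - c b (min p (D.t i.castSucc))) := fun i => by
    have hi : D.t i.castSucc ≤ D.t i.succ := D.strictMono_t.monotone i.castSucc_lt_succ.le
    simp only [apply_min_sub_apply_min (c _) hi, sub_sub_sub_cancel_right]
    set s := D.t i.castSucc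
    set t := D.t i.succ
    by_cases h : t ≤ p ∨ q ≤ s
    · have : max s (min p t) = max s (min q t) := by
        rcases h with h | h
        · rw [min_eq_right h, min_eq_right (h.trans hpq)]
        · rw [max_eq_left ((min_le_left _ _).trans (hpq.trans h)),
            max_eq_left ((min_le_left _ _).trans h)]
      rw [this, sub_self, sub_self]
    · rw [not_or, not_le, not_le] at h
      refine spectralClass_sub_eq (s := Set.Icc p q ∩ Set.Icc s t)
        (T := fun s => (L s : H →L[ℝ] H)) ?_ (continuous_subtype_val.comp L.continuous)
        (fun y => (L y).2.1) (fun y => (L y).2.2.2) (D.a_pos i) hb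
        (AdmissibleOn.mono ⟨D.continuousOn i, D.finite_rank i⟩ Set.inter_subset_right)
        (hadm.mono Set.inter_subset_left) ?_ ?_
      · rw [Set.Icc_inter_Icc]; exact isPreconnected_Icc
      · rw [min_eq_left h.1.le]
        exact ⟨⟨le_max_right _ _, max_le h.2.le hpq⟩, le_max_left _ _, max_le hi h.1.le⟩
      · exact ⟨⟨le_max_of_le_right (le_min hpq h.1.le), max_le h.2.le (min_le_left _ _)⟩,
          le_max_left _ _, max_le hi (min_le_right _ _)⟩
  have htel : ∀ x : unitInterval, ∑ i : Fin D.N,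
      (c b (min x (D.t i.succ)) - c b (min x (D.t i.castSucc))) = c b x - c b 0 := fun x => by
    rw [sum_succ_sub_castSucc fun i => c b (min x (D.t i)), D.t_zero, D.t_last,
      min_eq_left unitInterval.le_one', min_eq_right unitInterval.nonneg']
  calc D.partialFlow q - D.partialFlow p = _ := (Finset.sum_sub_distrib _ _).symm
    _ = _ := Finset.sum_congr rfl fun i _ => hterm i
    _ = _ := by rw [Finset.sum_sub_distrib, htel, htel, sub_sub_sub_cancel_right]

/-- The defining sum of the spectral flow does not depend on the partition. -/
theorem AdmissiblePartition.flow_eq {L : C(unitInterval, FS G H)} (D D' : AdmissiblePartition L) :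
    D.flow = D'.flow := by
  -- Telescope the partial flow of `D` over the points of `D'`; each increment is then a term of
  -- `D'.flow`.
  rw [← D.partialFlow_one_sub, ← D'.t_zero, ← D'.t_last,
    ← sum_succ_sub_castSucc fun i => D.partialFlow (D'.t i)]
  refine Finset.sum_congr rfl fun i _ => ?_
  exact D.partialFlow_sub (D'.strictMono_t.monotone i.castSucc_lt_succ.le) (D'.a_pos i)
    ⟨D'.continuousOn i, D'.finite_rank i⟩

theorem existsUnique_isSpectralFlow {L : C(unitInterval, FS G H)} (D : AdmissiblePartition L) :
    ∃! x, IsSpectralFlow L x :=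
  ⟨D.flow, ⟨D, rfl⟩, by rintro _ ⟨D', rfl⟩; exact D'.flow_eq D⟩

theorem sfl_eq_flow {L : C(unitInterval, FS G H)} (D : AdmissiblePartition L) :
    sfl L = D.flow := by
  have h : ∃ x, IsSpectralFlow L x := ⟨D.flow, D, rfl⟩
  unfold sfl
  rw [dif_pos h]
  exact (existsUnique_isSpectralFlow D).unique h.choose_spec ⟨D, rfl⟩

end Partitions

/-! ### Homotopy invariance on a grid and the straight homotopy -/

section Homotopy

set_option linter.unusedSectionVars false

/-- The points `i / N` of the unit interval. -/
def gridPoint (N i : ℕ) : unitInterval := Set.projIcc 0 1 zero_le_one ((i : ℝ) / N)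

theorem gridPoint_zero (N : ℕ) : gridPoint N 0 = 0 := by
  unfold gridPoint
  rw [Nat.cast_zero, zero_div]
  exact Set.projIcc_left (zero_le_one : (0 : ℝ) ≤ 1)

theorem gridPoint_self {N : ℕ} (hN : 0 < N) : gridPoint N N = 1 := by
  unfold gridPoint
  rw [div_self (by positivity)]
  exact Set.projIcc_right (zero_le_one : (0 : ℝ) ≤ 1)

theorem coe_gridPoint {N i : ℕ} (hi : i ≤ N) : (gridPoint N i : ℝ) = i / N := by
  unfold gridPoint
  have hi' : (i : ℝ) ≤ N := by exact_mod_cast hi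
  rw [Set.projIcc_of_mem zero_le_one
    ⟨by positivity, div_le_one_of_le₀ hi' (Nat.cast_nonneg _)⟩]

theorem gridPoint_lt {N i j : ℕ} (hij : i < j) (hj : j ≤ N) : gridPoint N i < gridPoint N j := by
  rw [← Subtype.coe_lt_coe, coe_gridPoint hj, coe_gridPoint (hij.le.trans hj)]
  have : (0 : ℝ) < N := by exact_mod_cast (Nat.zero_le i).trans_lt (hij.trans_le hj)
  gcongr

theorem dist_gridPoint_le {N i : ℕ} (hi : i < N) {x : unitInterval}
    (hx : x ∈ Set.Icc (gridPoint N i) (gridPoint N (i + 1))) : dist x (gridPoint N i) ≤ 1 / N := by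
  have h1 : (gridPoint N i : ℝ) ≤ x := hx.1
  have h2 : (x : ℝ) ≤ gridPoint N (i + 1) := hx.2
  rw [coe_gridPoint (Nat.succ_le_of_lt hi), Nat.succ_eq_add_one, Nat.cast_add, Nat.cast_one, add_div, ← coe_gridPoint hi.le] at h2
  rw [Subtype.dist_eq, Real.dist_eq, abs_of_nonneg (by linarith)]
  linarith

/-- A grid refining an open cover of the unit square. -/
theorem exists_grid {ι : Type*} {c : ι → Set (unitInterval × unitInterval)}
    (hc : ∀ i, IsOpen (c i)) (hcov : Set.univ ⊆ ⋃ i, c i) :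
    ∃ N > 0, ∀ i < N, ∀ j < N, ∃ k,
      Set.Icc (gridPoint N i) (gridPoint N (i + 1)) ×ˢ
        Set.Icc (gridPoint N j) (gridPoint N (j + 1)) ⊆ c k := by
  obtain ⟨δ, hδ, hball⟩ := lebesgue_number_lemma_of_metric isCompact_univ hc hcov
  obtain ⟨n, hn⟩ := exists_nat_one_div_lt hδ
  refine ⟨n + 1, n.succ_pos, fun i hi j hj => ?_⟩
  obtain ⟨k, hk⟩ := hball (gridPoint (n + 1) i, gridPoint (n + 1) j) (Set.mem_univ _)
  refine ⟨k, fun x hx => hk ?_⟩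
  rw [Metric.mem_ball, Prod.dist_eq]
  have h1 := dist_gridPoint_le hi hx.1
  have h2 := dist_gridPoint_le hj hx.2
  push_cast at h1 h2
  exact max_lt (h1.trans_lt hn) (h2.trans_lt hn)

variable {G : Type v} [Group G] [TopologicalSpace G]
variable {H : Type u} [NormedAddCommGroup H] [InnerProductSpace ℝ H] [CompleteSpace H]
variable [DistribMulAction G H] [SMulCommClass G ℝ H] [ContinuousSMul G H]

theorem AdmissibleOn.comp {Y Z : Type*} [TopologicalSpace Y] [TopologicalSpace Z]
    {T : Y → H →L[ℝ] H} {a : ℝ} {s : Set Y} (h : AdmissibleOn T a s) {f : Z → Y}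
    (hf : Continuous f) {t : Set Z} (hft : Set.MapsTo f t s) : AdmissibleOn (T ∘ f) a t :=
  ⟨h.1.comp hf.continuousOn hft, fun y hy => h.2 (f y) (hft hy)⟩

theorem exists_isOpen_admissibleOn {Y : Type*} [TopologicalSpace Y] {T : Y → H →L[ℝ] H}
    (hTc : Continuous T) (hT : ∀ y, IsSelfAdjoint (T y)) {y : Y}
    (hy : BoundedBelowModFinite (T y)) : ∃ a > 0, ∃ U, IsOpen U ∧ y ∈ U ∧ AdmissibleOn T a U := by
  obtain ⟨a, ha, r, hr, hcont, hfin⟩ := hy.exists_continuousOn_spectralProjection (hT y)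
  refine ⟨a, ha, T ⁻¹' Metric.ball (T y) r, Metric.isOpen_ball.preimage hTc,
    Metric.mem_ball_self hr, ?_, fun z hz => hfin _ ⟨hT z, hz⟩⟩
  exact hcont.comp hTc.continuousOn fun z hz => ⟨hT z, hz⟩

theorem exists_admissible_grid {h : unitInterval × unitInterval → H →L[ℝ] H} (hc : Continuous h)
    (hs : ∀ y, IsSelfAdjoint (h y)) (hb : ∀ y, BoundedBelowModFinite (h y)) :
    ∃ N > 0, ∃ a : ℕ → ℕ → ℝ, ∀ i < N, ∀ j < N, 0 < a i j ∧ AdmissibleOn h (a i j)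
      (Set.Icc (gridPoint N i) (gridPoint N (i + 1)) ×ˢ
        Set.Icc (gridPoint N j) (gridPoint N (j + 1))) := by
  choose a ha U hU hyU hadm using fun y => exists_isOpen_admissibleOn hc hs (hb y)
  obtain ⟨N, hN, hgrid⟩ := exists_grid hU fun y _ => Set.mem_iUnion.2 ⟨y, hyU y⟩
  refine ⟨N, hN, ?_⟩
  choose! k hk using hgrid
  exact ⟨fun i j => a (k i j), fun i hi j hj => ⟨ha _, (hadm _).mono (hk i hi j hj)⟩⟩

variable (G) in
/-- The sum of the increments of `[E(·,[0,a j])]` over the grid points of the row at `s`. -/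
def rowFlow (h : unitInterval × unitInterval → H →L[ℝ] H) (N : ℕ) (a : ℕ → ℝ) (s : unitInterval) :
    RO.{u, v} G :=
  ∑ j ∈ Finset.range N, (spectralClass G (h (s, gridPoint N (j + 1))) (a j) -
    spectralClass G (h (s, gridPoint N j)) (a j))

/-- Changing the admissible numbers does not change the flow of a row. -/
theorem rowFlow_congr {h : unitInterval × unitInterval → H →L[ℝ] H} (hc : Continuous h)
    (hs : ∀ y, IsSelfAdjoint (h y)) (hG : ∀ y, IsEquivariant G (h y)) {N : ℕ} {a b : ℕ → ℝ}
    {s : unitInterval} (ha : ∀ j < N, 0 < a j) (hb : ∀ j < N, 0 < b j)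
    (hAa : ∀ j < N, AdmissibleOn h (a j)
      ({s} ×ˢ Set.Icc (gridPoint N j) (gridPoint N (j + 1))))
    (hAb : ∀ j < N, AdmissibleOn h (b j)
      ({s} ×ˢ Set.Icc (gridPoint N j) (gridPoint N (j + 1)))) :
    rowFlow G h N a s = rowFlow G h N b s := by
  refine Finset.sum_congr rfl fun j hj => ?_
  have hj' := Finset.mem_range.1 hj
  have hle := (gridPoint_lt (Nat.lt_succ_self j) hj').le
  exact spectralClass_sub_eq (isPreconnected_singleton.prod isPreconnected_Icc) hc hs hG
    (ha j hj') (hb j hj') (hAa j hj') (hAb j hj') ⟨rfl, le_rfl, hle⟩ ⟨rfl, hle, le_rfl⟩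

/-- Neighbouring rows with the same admissible numbers and endpoints have the same flow. -/
theorem rowFlow_eq {h : unitInterval × unitInterval → H →L[ℝ] H} (hc : Continuous h)
    (hs : ∀ y, IsSelfAdjoint (h y)) (hG : ∀ y, IsEquivariant G (h y)) {N : ℕ} (hN : 0 < N)
    {a : ℕ → ℝ} {p q : unitInterval} (hpq : p ≤ q) (ha : ∀ j < N, 0 < a j)
    (hA : ∀ j < N, AdmissibleOn h (a j)
      (Set.Icc p q ×ˢ Set.Icc (gridPoint N j) (gridPoint N (j + 1))))
    (h0 : h (p, 0) = h (q, 0)) (h1 : h (p, 1) = h (q, 1)) :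
    rowFlow G h N a p = rowFlow G h N a q := by
  -- `d j k` is the change from row `p` to row `q` at grid point `k`, measured with the number of
  -- cell `j`. At an interior point the two adjacent cells give the same change.
  set d : ℕ → ℕ → RO.{u, v} G := fun j k =>
    spectralClass G (h (q, gridPoint N k)) (a j) - spectralClass G (h (p, gridPoint N k)) (a j)
    with hd
  have hstep : ∀ k, k + 1 < N → d k (k + 1) = d (k + 1) (k + 1) := fun k hk => by
    have hk' := (Nat.lt_succ_self k).trans hk
    refine spectralClass_sub_eq (s := Set.Icc p q ×ˢ {gridPoint N (k + 1)})
      (isPreconnected_Icc.prod isPreconnected_singleton) hc hs hG (ha _ hk') (ha _ hk)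
      ((hA _ hk').mono (Set.prod_mono_right ?_)) ((hA _ hk).mono (Set.prod_mono_right ?_))
      ⟨⟨le_rfl, hpq⟩, rfl⟩ ⟨⟨hpq, le_rfl⟩, rfl⟩
    · exact Set.singleton_subset_iff.2 ⟨(gridPoint_lt (Nat.lt_succ_self k) hk').le, le_rfl⟩
    · exact Set.singleton_subset_iff.2 ⟨le_rfl, (gridPoint_lt (Nat.lt_succ_self (k + 1)) hk).le⟩
  -- Measuring at point `j` with the cell to its left keeps `e N` away from `a N`, about which
  -- nothing is known. The value 0 at `j = 0` is the true change, since that endpoint is fixed.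
  set e : ℕ → RO.{u, v} G := fun j => Nat.casesOn j 0 fun k => d k (k + 1) with he
  have heq : ∀ j < N, e j = d j j := fun j hj => by
    cases j with
    | zero =>
      change 0 = d 0 0
      simp only [hd, gridPoint_zero, h0, sub_self]
    | succ k => exact hstep k hj
  have heN : e N = 0 := by
    obtain ⟨k, rfl⟩ := Nat.exists_eq_succ_of_ne_zero hN.ne'
    change d k (k + 1) = 0
    simp only [hd, gridPoint_self hN, h1, sub_self]
  refine (sub_eq_zero.1 ?_).symm
  calc rowFlow G h N a q - rowFlow G h N a p
      = ∑ j ∈ Finset.range N, (e (j + 1) - e j) := by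
        unfold rowFlow
        rw [← Finset.sum_sub_distrib]
        refine Finset.sum_congr rfl fun j hj => ?_
        rw [heq j (Finset.mem_range.1 hj)]
        change _ = d j (j + 1) - d j j
        simp only [hd]
        abel
    _ = e N - e 0 := Finset.sum_range_sub e N
    _ = 0 := by rw [heN]; exact sub_self 0

/-- The partition of a path by grid points. -/
def gridPartition (L : C(unitInterval, FS G H)) {N : ℕ} (hN : 0 < N) {a : ℕ → ℝ}
    (ha : ∀ j < N, 0 < a j)
    (hA : ∀ j < N, AdmissibleOn (fun s => (L s : H →L[ℝ] H)) (a j)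
      (Set.Icc (gridPoint N j) (gridPoint N (j + 1)))) : AdmissiblePartition L where
  N := N
  t i := gridPoint N i
  t_zero := gridPoint_zero N
  t_last := gridPoint_self hN
  strictMono_t _ j hij := gridPoint_lt hij (Nat.lt_succ_iff.1 j.2)
  a j := a j
  a_pos j := ha j j.2
  continuousOn j := (hA j j.2).1
  finite_rank j := (hA j j.2).2

theorem flow_gridPartition (L : C(unitInterval, FS G H)) {N : ℕ} (hN : 0 < N) {a : ℕ → ℝ}
    (ha : ∀ j < N, 0 < a j)
    (hA : ∀ j < N, AdmissibleOn (fun s => (L s : H →L[ℝ] H)) (a j)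
      (Set.Icc (gridPoint N j) (gridPoint N (j + 1))))
    {h : unitInterval × unitInterval → H →L[ℝ] H} {s : unitInterval}
    (hL : ∀ t, h (s, t) = L t) : (gridPartition L hN ha hA).flow = rowFlow G h N a s := by
  unfold rowFlow
  rw [Finset.sum_range]
  simp only [hL]
  rfl

/-- Homotopy invariance of the spectral flow with fixed endpoints. -/
theorem exists_admissiblePartition_flow_eq (L L' : C(unitInterval, FS G H))
    {h : unitInterval × unitInterval → H →L[ℝ] H} (hc : Continuous h)
    (hs : ∀ y, IsSelfAdjoint (h y)) (hG : ∀ y, IsEquivariant G (h y))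
    (hb : ∀ y, BoundedBelowModFinite (h y)) (hL : ∀ t, h (0, t) = L t)
    (hL' : ∀ t, h (1, t) = L' t) (h0 : ∀ p q, h (p, 0) = h (q, 0))
    (h1 : ∀ p q, h (p, 1) = h (q, 1)) :
    ∃ (D : AdmissiblePartition L) (D' : AdmissiblePartition L'), D.flow = D'.flow := by
  obtain ⟨N, hN, a, ha⟩ := exists_admissible_grid hc hs hb
  have hle : ∀ {i}, i < N → gridPoint N i ≤ gridPoint N (i + 1) := fun hi =>
    (gridPoint_lt (Nat.lt_succ_self _) hi).le
  have hstep : ∀ i < N, rowFlow G h N (a i) (gridPoint N i) =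
      rowFlow G h N (a i) (gridPoint N (i + 1)) := fun i hi =>
    rowFlow_eq hc hs hG hN (hle hi) (fun j hj => (ha i hi j hj).1)
      (fun j hj => (ha i hi j hj).2) (h0 _ _) (h1 _ _)
  have hchange : ∀ i, i + 1 < N → rowFlow G h N (a i) (gridPoint N (i + 1)) =
      rowFlow G h N (a (i + 1)) (gridPoint N (i + 1)) := fun i hi => by
    have hi' := (Nat.lt_succ_self i).trans hi
    refine rowFlow_congr hc hs hG (fun j hj => (ha i hi' j hj).1)
      (fun j hj => (ha _ hi j hj).1) (fun j hj => (ha i hi' j hj).2.mono ?_)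
      (fun j hj => (ha _ hi j hj).2.mono ?_)
    · exact Set.prod_mono_left (Set.singleton_subset_iff.2 ⟨hle hi', le_rfl⟩)
    · exact Set.prod_mono_left (Set.singleton_subset_iff.2 ⟨le_rfl, hle hi⟩)
  have hall : ∀ i < N, rowFlow G h N (a 0) 0 = rowFlow G h N (a i) (gridPoint N (i + 1)) :=
    fun i => by
      induction i with
      | zero => intro hi; rw [← hstep 0 hi, gridPoint_zero]
      | succ i ih =>
        intro hi
        rw [ih ((Nat.lt_succ_self i).trans hi), hchange i hi, hstep _ hi]
  -- The row at 1 is the far edge of the last strip, so its numbers are those of strip `k = N - 1`.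
  obtain ⟨k, hk⟩ := Nat.exists_eq_succ_of_ne_zero hN.ne'
  have hkN : k < N := by omega
  have hk1 : gridPoint N (k + 1) = 1 := by rw [← Nat.succ_eq_add_one, ← hk, gridPoint_self hN]
  have hA : ∀ j < N, AdmissibleOn (fun s => (L s : H →L[ℝ] H)) (a 0 j)
      (Set.Icc (gridPoint N j) (gridPoint N (j + 1))) := fun j hj => by
    have := (ha 0 hN j hj).2.comp (f := fun t => (0, t)) (by fun_prop)
      (t := Set.Icc (gridPoint N j) (gridPoint N (j + 1)))
      fun t ht => ⟨⟨(gridPoint_zero N).le, unitInterval.nonneg'⟩, ht⟩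
    rwa [show h ∘ (fun t => (0, t)) = fun s => (L s : H →L[ℝ] H) from funext hL] at this
  have hA' : ∀ j < N, AdmissibleOn (fun s => (L' s : H →L[ℝ] H)) (a k j)
      (Set.Icc (gridPoint N j) (gridPoint N (j + 1))) := fun j hj => by
    have := (ha k hkN j hj).2.comp (f := fun t => (1, t)) (by fun_prop)
      (t := Set.Icc (gridPoint N j) (gridPoint N (j + 1)))
      fun t ht => ⟨⟨unitInterval.le_one', hk1.ge⟩, ht⟩
    rwa [show h ∘ (fun t => (1, t)) = fun s => (L' s : H →L[ℝ] H) from funext hL'] at this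
  refine ⟨gridPartition L hN (fun j hj => (ha 0 hN j hj).1) hA,
    gridPartition L' hN (fun j hj => (ha k hkN j hj).1) hA', ?_⟩
  rw [flow_gridPartition L hN _ hA hL, flow_gridPartition L' hN _ hA' hL', hall k hkN, hk1]

/-- Paths with compact difference and common endpoints have partitions with the same flow. -/
theorem exists_flow_eq_of_isCompactOperator_sub (L L' : C(unitInterval, FS G H))
    (h0 : L 0 = L' 0) (h1 : L 1 = L' 1)
    (hcompact : ∀ s, IsCompactOperator ((L s : H →L[ℝ] H) - (L' s : H →L[ℝ] H))) :
    ∃ (D : AdmissiblePartition L) (D' : AdmissiblePartition L'), D.flow = D'.flow := by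
  have hLc : Continuous fun s => (L s : H →L[ℝ] H) := continuous_subtype_val.comp L.continuous
  have hLc' : Continuous fun s => (L' s : H →L[ℝ] H) := continuous_subtype_val.comp L'.continuous
  have hsub : ∀ y : unitInterval × unitInterval,
      IsSelfAdjoint ((-(y.1 : ℝ)) • ((L y.2 : H →L[ℝ] H) - (L' y.2 : H →L[ℝ] H))) := fun y =>
    (IsSelfAdjoint.all _).smul ((L y.2).2.1.sub (L' y.2).2.1)
  refine exists_admissiblePartition_flow_eq L L'
    (h := fun y => (L y.2 : H →L[ℝ] H) +
      (-(y.1 : ℝ)) • ((L y.2 : H →L[ℝ] H) - (L' y.2 : H →L[ℝ] H)))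
    ?_ (fun y => (L y.2).2.1.add (hsub y)) (fun y g x => ?_) (fun y => ?_) (fun t => ?_)
    (fun t => ?_) (fun p q => ?_) fun p q => ?_
  · exact (hLc.comp continuous_snd).add ((by fun_prop :
      Continuous fun y : unitInterval × unitInterval => -(y.1 : ℝ)).smul
        ((hLc.comp continuous_snd).sub (hLc'.comp continuous_snd)))
  · simp only [add_apply, smul_apply, sub_apply, (L y.2).2.2.2 g x, (L' y.2).2.2.2 g x, smul_add,
      ← smul_sub, smul_comm g]
  -- Compactness of the difference is needed only here, to keep the whole homotopy bounded below
  -- modulo finite dimension.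
  · exact (L y.2).2.2.1.boundedBelowModFinite.add_compact ((hcompact y.2).smul _) (hsub y)
  · simp
  · simp
  · simp [h0]
  · simp [h1]

end Homotopy

end EquivariantSpectralFlow

end

theorem proposition2p2
    {E : Type*} [NormedAddCommGroup E] [NormedSpace ℝ E] [FiniteDimensional ℝ E]
    {G : Type v} [Group G] [TopologicalSpace G] [ChartedSpace E G]
    [LieGroup (modelWithCornersSelf ℝ E) ∞ G] [CompactSpace G]
    {H : Type u} [NormedAddCommGroup H] [InnerProductSpace ℝ H] [CompleteSpace H]
    [TopologicalSpace.SeparableSpace H]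
    [DistribMulAction G H] [SMulCommClass G ℝ H] [IsIsometricSMul G H] [ContinuousSMul G H]
    (L L' : C(unitInterval, EquivariantSpectralFlow.FS G H))
    (h0 : L 0 = L' 0) (h1 : L 1 = L' 1)
    (hcompact : ∀ s : unitInterval,
      IsCompactOperator ((L s : H →L[ℝ] H) - (L' s : H →L[ℝ] H))) :
    (∃! x, EquivariantSpectralFlow.IsSpectralFlow L x) ∧
      (∃! x, EquivariantSpectralFlow.IsSpectralFlow L' x) ∧
      EquivariantSpectralFlow.sfl L = EquivariantSpectralFlow.sfl L' := by
  obtain ⟨D, D', hD⟩ := EquivariantSpectralFlow.exists_flow_eq_of_isCompactOperator_sub L L' h0 h1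
    hcompact
  refine ⟨EquivariantSpectralFlow.existsUnique_isSpectralFlow D,
    EquivariantSpectralFlow.existsUnique_isSpectralFlow D', ?_⟩
  rw [EquivariantSpectralFlow.sfl_eq_flow D, EquivariantSpectralFlow.sfl_eq_flow D', hD]
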